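/- Let $n\ge 2$ be an integer. A Delzant polytope in $\mathbb{R}^n$ is a full-dimensional convex polytope $P\subset\mathbb{R}^n$ whose normal fan is unimodular, that is, the normal cone of every face of $P$ is generated by linearly independent primitive integer vectors $v_1,\dots,v_k$ that form a $\mathbb{Z}$-basis of $\operatorname{span}_{\mathbb{R}}(v_1,\dots,v_k)\cap\mathbb{Z}^n$. Let $\mathcal{D}(n)$ be the set of all Delzant polytopes in $\mathbb{R}^n$ and let $\mathcal{D}_f^m(n)\subset\mathcal{D}(n)$ be the set of those that have exactly $m$ facets. Both sets carry two distances: the Hausdorff distance $\delta^H$ and the symmetric difference distance $\delta^V(P,Q)=\operatorname{Vol}(P\setminus Q)+\operatorname{Vol}(Q\setminus P)$. Let $\operatorname{AGL}(n,\mathbb{Z})$ be the group of all maps $x\mapsto Ax+c$ with $A\in\operatorname{GL}(n,\mathbb{Z})$ and $c\in\mathbb{Z}^n$. Let $\widetilde{\mathcal{D}(n)}$ and $\widetilde{\mathcal{D}_f^m(n)}$ be the sets of $\operatorname{AGL}(n,\mathbb{Z})$-orbits in $\mathcal{D}(n)$ and in $\mathcal{D}_f^m(n)$, with the distance $\widetilde{\delta^V}([P],[Q])=\inf\{\delta^V(P',Q')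 : P'\in[P],\ Q'\in[Q]\}$, which is a metric. Then: (1) For every integer $m\ge n+1$, the Hausdorff dimension of $\mathcal{D}_f^m(n)$, with respect to $\delta^H$ as well as with respect to $\delta^V$, is exactly $m$, and the Hausdorff dimension of $\widetilde{\mathcal{D}_f^m(n)}$ with respect to $\widetilde{\delta^V}$ is exactly $m$. (2) The Hausdorff dimension of $\mathcal{D}(n)$, with respect to $\delta^H$ as well as with respect to $\delta^V$, is $\infty$, and the Hausdorff dimension of $\widetilde{\mathcal{D}(n)}$ with respect to $\widetilde{\delta^V}$ is $\infty$. -/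

import Mathlib

namespace Delzant

/-- The Euclidean space `ℝⁿ`; it is identified with its dual through the inner product. -/
abbrev Pt (n : ℕ) : Type := EuclideanSpace ℝ (Fin n)

/-- An integer vector, seen as a point of `ℝⁿ`. -/
noncomputable def intPt {n : ℕ} (v : Fin n → ℤ) : Pt n := WithLp.toLp 2 (fun i => (v i : ℝ))

/-! ### Polytopes, faces, normal fans -/

/-- A full-dimensional polytope: the convex hull of finitely many points, affinely spanning `ℝⁿ`. -/
def IsFullDimPolytope {n : ℕ} (P : Set (Pt n)) : Prop :=
  (∃ S : Finset (Pt n), P = convexHull ℝ (S : Set (Pt n))) ∧ affineSpan ℝ P = ⊤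

/-- The face `F_α(P)` of `P` in the direction of `α`: the points of `P` that maximize `α`. -/
def faceDir {n : ℕ} (P : Set (Pt n)) (α : Pt n) : Set (Pt n) :=
  {p | p ∈ P ∧ ∀ x ∈ P, inner ℝ α x ≤ inner ℝ α p}

/-- `F` is a face of `P`. (The polytope `P` is the face in the direction `0`; for a polytope, all
these faces are nonempty.) -/
def IsFace {n : ℕ} (P F : Set (Pt n)) : Prop := ∃ α : Pt n, F = faceDir P α

/-- A facet of a full-dimensional polytope in `ℝⁿ`: a face of dimension `n - 1`. -/
def IsFacet {n : ℕ} (P F : Set (Pt n)) : Prop :=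
  IsFace P F ∧ Module.finrank ℝ (vectorSpan ℝ F) + 1 = n

/-- The normal cone of a face `F` of `P`. -/
def normalCone {n : ℕ} (P F : Set (Pt n)) : Set (Pt n) := {α | F ⊆ faceDir P α}

/-- The normal fan of `P`: the collection of the normal cones of all faces of `P`. -/
def normalFan {n : ℕ} (P : Set (Pt n)) : Set (Set (Pt n)) :=
  {C | ∃ F, IsFace P F ∧ C = normalCone P F}

/-- The cone generated by finitely many vectors. -/
def coneGen {n k : ℕ} (v : Fin k → Pt n) : Set (Pt n) :=
  {x | ∃ a : Fin k → ℝ, (∀ i, 0 ≤ a i) ∧ x = ∑ i, a i • v i}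

/-- A unimodular cone: it is generated by linearly independent primitive integer vectors
`v₁, …, v_k` (so it is rational and simplicial), and the lattice generated by `v₁, …, v_k` is the
whole of `span_ℝ(v₁, …, v_k) ∩ ℤⁿ` (so its multiplicity, the index of the first lattice in the
second one, is one). -/
def IsUnimodularCone {n : ℕ} (C : Set (Pt n)) : Prop :=
  ∃ (k : ℕ) (v : Fin k → Fin n → ℤ),
    (∀ i, Finset.univ.gcd (v i) = 1) ∧
    LinearIndependent ℝ (fun i => intPt (v i)) ∧
    C = coneGen (fun i => intPt (v i)) ∧
    ∀ w : Fin n → ℤ, intPt w ∈ Submodule.span ℝ (Set.range fun i => intPt (v i)) →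
      w ∈ Submodule.span ℤ (Set.range v)

/-- A Delzant polytope in `ℝⁿ`: a full-dimensional polytope whose normal fan is unimodular. -/
def IsDelzant {n : ℕ} (P : Set (Pt n)) : Prop :=
  IsFullDimPolytope P ∧ ∀ C ∈ normalFan P, IsUnimodularCone C

/-- `P` has exactly `m` facets. -/
def HasFacets {n : ℕ} (P : Set (Pt n)) (m : ℕ) : Prop := {F | IsFacet P F}.encard = m

/-! ### Proper convex bodies with the symmetric difference distance -/

/-- Proper convex bodies: compact convex sets with nonempty interior. This is a new structure, so
that it does not inherit the Hausdorff distance that `ConvexBody` carries. -/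
@[ext]
structure ProperBody (n : ℕ) where
  /-- the underlying convex body -/
  body : ConvexBody (Pt n)
  interior_nonempty : (interior (body : Set (Pt n))).Nonempty

namespace ProperBody

variable {n : ℕ}

/-- The underlying set. -/
def toSet (P : ProperBody n) : Set (Pt n) := (P.body : Set (Pt n))

theorem toSet_injective : Function.Injective (toSet : ProperBody n → Set (Pt n)) := by
  intro P Q h
  exact ProperBody.ext (SetLike.coe_injective h)

theorem subset_of_volume_diff (P Q : ProperBody n)
    (h : MeasureTheory.volume (P.toSet \ Q.toSet) = 0) : P.toSet ⊆ Q.toSet := by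
  have hQ : IsClosed Q.toSet := Q.body.isClosed
  have h1 : interior P.toSet \ Q.toSet = ∅ := by
    have ho : IsOpen (interior P.toSet \ Q.toSet) := isOpen_interior.sdiff hQ
    by_contra hne
    have := ho.measure_pos MeasureTheory.volume (Set.nonempty_iff_ne_empty.2 hne)
    have h2 := MeasureTheory.measure_mono (μ := MeasureTheory.volume)
      (Set.sdiff_subset_sdiff_left (t := Q.toSet) (interior_subset (s := P.toSet)))
    rw [h] at h2
    exact absurd (lt_of_lt_of_le this h2) (lt_irrefl _)
  have h3 : closure (interior P.toSet) ⊆ Q.toSet :=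
    closure_minimal (Set.sdiff_eq_empty.1 h1) hQ
  have h4 : closure (interior P.toSet) = closure P.toSet :=
    P.body.convex.closure_interior_eq_closure_of_nonempty_interior P.interior_nonempty
  exact (subset_closure.trans h4.symm.subset).trans h3

/-- The symmetric difference distance `δ^V(P, Q) = Vol(P \ Q) + Vol(Q \ P)`. -/
noncomputable instance : EMetricSpace (ProperBody n) where
  edist P Q := MeasureTheory.volume (P.toSet \ Q.toSet) + MeasureTheory.volume (Q.toSet \ P.toSet)
  edist_self P := by simp
  edist_comm P Q := add_comm _ _
  edist_triangle P Q R := by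
    have key : ∀ A B C : Set (Pt n), MeasureTheory.volume (A \ C) ≤
        MeasureTheory.volume (A \ B) + MeasureTheory.volume (B \ C) := by
      intro A B C
      refine (MeasureTheory.measure_mono ?_).trans (MeasureTheory.measure_union_le _ _)
      intro x hx
      by_cases hB : x ∈ B
      · exact Or.inr ⟨hB, hx.2⟩
      · exact Or.inl ⟨hx.1, hB⟩
    calc _ ≤ (MeasureTheory.volume (P.toSet \ Q.toSet) + MeasureTheory.volume (Q.toSet \ R.toSet))
          + (MeasureTheory.volume (R.toSet \ Q.toSet) + MeasureTheory.volume (Q.toSet \ P.toSet)) :=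
          add_le_add (key _ _ _) (key _ _ _)
      _ = _ := by ring
  eq_of_edist_eq_zero := by
    intro P Q h
    have h' := add_eq_zero.1 h
    exact toSet_injective
      ((subset_of_volume_diff P Q h'.1).antisymm (subset_of_volume_diff Q P h'.2))

theorem edist_def (P Q : ProperBody n) : edist P Q =
    MeasureTheory.volume (P.toSet \ Q.toSet) + MeasureTheory.volume (Q.toSet \ P.toSet) := rfl

end ProperBody

/-! ### The group `AGL(n, ℤ)` and the quotient metric space -/

/-- The group `AGL(n, ℤ)` of the maps `x ↦ A x + c` with `A ∈ GL(n, ℤ)` and `c ∈ ℤⁿ`. -/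
def AGLZ (n : ℕ) : Subgroup (Pt n ≃ᵃ[ℝ] Pt n) where
  carrier := {g | ∃ (A : Matrix.GeneralLinearGroup (Fin n) ℤ) (c : Fin n → ℤ),
    ∀ x i, g x i = ∑ j, ((A : Matrix (Fin n) (Fin n) ℤ) i j : ℝ) * x j + (c i : ℝ)}
  one_mem' := by
    refine ⟨1, 0, fun x i => ?_⟩
    simp [Matrix.one_apply]
  mul_mem' := by
    rintro g h ⟨A, c, hg⟩ ⟨B, d, hh⟩
    refine ⟨A * B, fun i => ∑ j, (A : Matrix (Fin n) (Fin n) ℤ) i j * d j + c i, fun x i => ?_⟩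
    rw [AffineEquiv.mul_def, AffineEquiv.trans_apply, hg]
    simp only [hh, Units.val_mul, Matrix.mul_apply]
    push_cast
    simp only [mul_add, Finset.sum_add_distrib, Finset.mul_sum, Finset.sum_mul]
    rw [Finset.sum_comm, add_assoc]
    congr 1
    exact Finset.sum_congr rfl fun k _ => Finset.sum_congr rfl fun j _ => by ring
  inv_mem' := by
    rintro g ⟨A, c, hg⟩
    obtain ⟨B, hBA⟩ : ∃ B : Matrix.GeneralLinearGroup (Fin n) ℤ, B * A = 1 :=
      ⟨A⁻¹, inv_mul_cancel A⟩
    refine ⟨B, fun i => -∑ j, (B : Matrix (Fin n) (Fin n) ℤ) i j * c j, fun x i => ?_⟩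
    obtain ⟨y, rfl⟩ := g.surjective x
    have hinv : g⁻¹ (g y) = y := g.symm_apply_apply y
    have hB : ∀ i k, ∑ j, (((B : Matrix (Fin n) (Fin n) ℤ) i j : ℤ) : ℝ) *
        (((A : Matrix (Fin n) (Fin n) ℤ) j k : ℤ) : ℝ) = if i = k then 1 else 0 := by
      intro i k
      have h1 : ((B * A : Matrix.GeneralLinearGroup (Fin n) ℤ) : Matrix (Fin n) (Fin n) ℤ) i k
          = if i = k then 1 else 0 := by
        rw [hBA]; simp [Matrix.one_apply]
      rw [Units.val_mul, Matrix.mul_apply] at h1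
      exact_mod_cast h1
    rw [hinv]
    simp only [hg, mul_add, Finset.sum_add_distrib, Finset.mul_sum]
    push_cast
    rw [Finset.sum_comm, add_neg_cancel_right]
    simp only [← mul_assoc, ← Finset.sum_mul, hB]
    simp

namespace AGLZ

variable {n : ℕ}

theorem volume_image (g : AGLZ n) (s : Set (Pt n)) :
    MeasureTheory.volume ((g : Pt n ≃ᵃ[ℝ] Pt n) '' s) = MeasureTheory.volume s := by
  obtain ⟨g, A, c, hg⟩ := g
  change MeasureTheory.volume (g '' s) = _
  set L : Pt n →ₗ[ℝ] Pt n :=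
    Matrix.toLpLin 2 2 ((A : Matrix (Fin n) (Fin n) ℤ).map (Int.cast : ℤ → ℝ)) with hL
  have h1 : g '' s = (fun x => intPt c + x) '' (L '' s) := by
    rw [Set.image_image]
    refine Set.image_congr fun x _ => ?_
    ext i
    rw [hg]
    simp [hL, intPt, Matrix.toLpLin_apply, Matrix.mulVec, dotProduct, add_comm]
  have hdet : |LinearMap.det L| = 1 := by
    have h2 : LinearMap.det L = ((A : Matrix (Fin n) (Fin n) ℤ).det : ℝ) := by
      rw [hL, Matrix.toLpLin_eq_toLin, LinearMap.det_toLin]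
      exact (Int.cast_det _).symm
    have h3 : IsUnit (A : Matrix (Fin n) (Fin n) ℤ).det :=
      (Matrix.isUnit_iff_isUnit_det _).1 A.isUnit
    rw [h2]
    rcases Int.isUnit_iff.1 h3 with h | h <;> rw [h] <;> simp
  rw [h1, Set.image_add_left, MeasureTheory.measure_preimage_add,
    MeasureTheory.Measure.addHaar_image_linearMap, hdet]
  simp

/-- `AGL(n, ℤ)` acts on proper convex bodies by taking images. -/
noncomputable instance : MulAction (AGLZ n) (ProperBody n) where
  smul g P :=
    { body :=
        { carrier := (g : Pt n ≃ᵃ[ℝ] Pt n) '' P.toSet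
          convex' := P.body.convex.affine_image ((g : Pt n ≃ᵃ[ℝ] Pt n) : Pt n →ᵃ[ℝ] Pt n)
          isCompact' := P.body.isCompact.image (g : Pt n ≃ᵃ[ℝ] Pt n).continuous_of_finiteDimensional
          nonempty' := P.body.nonempty.image _ }
      interior_nonempty := by
        have hi : (g : Pt n ≃ᵃ[ℝ] Pt n) '' interior P.toSet =
            interior ((g : Pt n ≃ᵃ[ℝ] Pt n) '' P.toSet) :=
          (AffineEquiv.toContinuousAffineEquiv
            (g : Pt n ≃ᵃ[ℝ] Pt n)).toHomeomorph.image_interior P.toSet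
        change (interior ((g : Pt n ≃ᵃ[ℝ] Pt n) '' P.toSet)).Nonempty
        rw [← hi]
        exact P.interior_nonempty.image _ }
  one_smul P := ProperBody.toSet_injective (Set.image_id _)
  mul_smul g h P := ProperBody.toSet_injective (by
    change (fun x => (g : Pt n ≃ᵃ[ℝ] Pt n) ((h : Pt n ≃ᵃ[ℝ] Pt n) x)) '' P.toSet =
      (g : Pt n ≃ᵃ[ℝ] Pt n) '' ((h : Pt n ≃ᵃ[ℝ] Pt n) '' P.toSet)
    rw [Set.image_image])

theorem toSet_smul (g : AGLZ n) (P : ProperBody n) :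
    (g • P).toSet = (g : Pt n ≃ᵃ[ℝ] Pt n) '' P.toSet := rfl

theorem edist_smul (g : AGLZ n) (P Q : ProperBody n) : edist (g • P) (g • Q) = edist P Q := by
  simp only [ProperBody.edist_def, toSet_smul,
    ← Set.image_sdiff (g : Pt n ≃ᵃ[ℝ] Pt n).injective, volume_image]

/-- A proper convex body that is close to `P` contains a fixed ball. -/
theorem ball_subset_of_edist_lt {P Q : ProperBody n} {c : Pt n} {r : ℝ} (hr : 0 < r)
    (hP : Metric.closedBall c r ⊆ P.toSet)
    (h : edist P Q < MeasureTheory.volume (Metric.ball (0 : Pt n) (r / 4))) :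
    Metric.closedBall c (r / 2) ⊆ Q.toSet := by
  intro y hy
  by_contra hyQ
  obtain ⟨f, u, hfQ, hfy⟩ := geometric_hahn_banach_closed_point Q.body.convex Q.body.isClosed hyQ
  set a : Pt n := (InnerProductSpace.toDual ℝ (Pt n)).symm f with ha
  have hfa : ∀ x, f x = inner ℝ a x := fun x => by
    rw [ha, InnerProductSpace.toDual_symm_apply]
  have ha0 : a ≠ 0 := by
    intro h0
    obtain ⟨q, hq⟩ := Q.body.nonempty
    have h1 := hfQ q hq
    rw [hfa, h0, inner_zero_left] at h1 hfy
    linarith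
  have hna : 0 < ‖a‖ := norm_pos_iff.2 ha0
  set z : Pt n := y + (r / 4 / ‖a‖) • a with hz
  have hsub : Metric.ball z (r / 4) ⊆ P.toSet \ Q.toSet := by
    intro x hx
    rw [mem_ball_iff_norm] at hx
    constructor
    · apply hP
      rw [mem_closedBall_iff_norm] at hy ⊢
      have hzy : ‖(r / 4 / ‖a‖) • a‖ = r / 4 := by
        rw [norm_smul, Real.norm_of_nonneg (by positivity)]
        field_simp
      have hx' : x - c = (x - z) + (r / 4 / ‖a‖) • a + (y - c) := by rw [hz]; abel
      rw [hx']
      have h1 := norm_add₃_le (a := x - z) (b := (r / 4 / ‖a‖) • a) (c := y - c)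
      linarith
    · intro hxQ
      have h1 := hfQ x hxQ
      have hx' : x = (x - z) + (r / 4 / ‖a‖) • a + y := by rw [hz]; abel
      have h2 : f x = inner ℝ a (x - z) + (r / 4) * ‖a‖ + f y := by
        conv_lhs => rw [hx']
        rw [map_add, map_add, hfa, map_smul, hfa a, real_inner_self_eq_norm_sq, smul_eq_mul]
        field_simp
      have h3 := (abs_le.1 (abs_real_inner_le_norm a (x - z))).1
      have h4 : ‖a‖ * ‖x - z‖ ≤ ‖a‖ * (r / 4) := by gcongr
      nlinarith
  have hle : MeasureTheory.volume (Metric.ball (0 : Pt n) (r / 4)) ≤ edist P Q := by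
    rw [← MeasureTheory.Measure.addHaar_ball_center MeasureTheory.volume z (r / 4)]
    exact (MeasureTheory.measure_mono hsub).trans le_self_add
  exact absurd h (not_lt.2 hle)

/-- Only finitely many elements of `AGL(n, ℤ)` map a given ball into a given bounded set. -/
theorem finite_mapsTo (c : Pt n) {r : ℝ} (hr : 0 < r) (R : ℝ) :
    {g : AGLZ n | (g : Pt n ≃ᵃ[ℝ] Pt n) '' Metric.closedBall c r ⊆ Metric.closedBall 0 R}.Finite := by
  have hdata : ∀ g : AGLZ n, ∃ d : (Fin n → Fin n → ℤ) × (Fin n → ℤ),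
      ∀ x i, (g : Pt n ≃ᵃ[ℝ] Pt n) x i = ∑ j, (d.1 i j : ℝ) * x j + (d.2 i : ℝ) := by
    rintro ⟨g, A, c, hg⟩
    exact ⟨(fun i j => (A : Matrix (Fin n) (Fin n) ℤ) i j, c), hg⟩
  choose d hd using hdata
  have hinj : Function.Injective d := by
    intro g h hgh
    apply Subtype.ext
    ext x i
    rw [hd, hd, hgh]
  set M : ℤ := ⌈2 * R / r⌉ with hM
  set N : ℤ := ⌈R + ∑ j, (M : ℝ) * |c j|⌉ with hN
  have hfin : (Set.Icc (fun _ _ => -M : Fin n → Fin n → ℤ) (fun _ _ => M) ×ˢ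
      Set.Icc (fun _ => -N : Fin n → ℤ) (fun _ => N)).Finite :=
    (Set.finite_Icc _ _).prod (Set.finite_Icc _ _)
  refine (hfin.preimage (hinj.injOn (s := d ⁻¹' _))).subset ?_
  intro g hg
  have hcoord : ∀ x ∈ Metric.closedBall c r, ∀ i, |(g : Pt n ≃ᵃ[ℝ] Pt n) x i| ≤ R := by
    intro x hx i
    have h1 := hg (Set.mem_image_of_mem _ hx)
    rw [mem_closedBall_zero_iff] at h1
    exact (PiLp.norm_apply_le _ i).trans h1
  have hA : ∀ i j, |((d g).1 i j : ℝ)| ≤ M := by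
    intro i j
    have h1 := hcoord c (Metric.mem_closedBall_self hr.le) i
    have h2 := hcoord (c + EuclideanSpace.single j r) (by
      rw [mem_closedBall_iff_norm]; simp [abs_of_pos hr]) i
    have h3 : (g : Pt n ≃ᵃ[ℝ] Pt n) (c + EuclideanSpace.single j r) i =
        (g : Pt n ≃ᵃ[ℝ] Pt n) c i + ((d g).1 i j : ℝ) * r := by
      rw [hd, hd]
      simp [mul_add, Finset.sum_add_distrib]
      ring
    rw [h3] at h2
    have h4 : |((d g).1 i j : ℝ) * r| ≤ 2 * R := by
      rw [abs_le] at *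
      constructor <;> linarith [h1.1, h1.2, h2.1, h2.2]
    rw [abs_mul, abs_of_pos hr] at h4
    exact ((le_div_iff₀ hr).2 h4).trans (Int.le_ceil _)
  have hc : ∀ i, |((d g).2 i : ℝ)| ≤ N := by
    intro i
    have h1 := hcoord c (Metric.mem_closedBall_self hr.le) i
    have h2 : |∑ j, ((d g).1 i j : ℝ) * c j| ≤ ∑ j, (M : ℝ) * |c j| := by
      refine (Finset.abs_sum_le_sum_abs _ _).trans (Finset.sum_le_sum fun j _ => ?_)
      rw [abs_mul]
      exact mul_le_mul_of_nonneg_right (hA i j) (abs_nonneg _)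
    have h3 : ((d g).2 i : ℝ) = (g : Pt n ≃ᵃ[ℝ] Pt n) c i - ∑ j, ((d g).1 i j : ℝ) * c j := by
      rw [hd]; ring
    rw [h3]
    exact ((abs_sub _ _).trans (add_le_add h1 h2)).trans (Int.le_ceil _)
  have hA' : ∀ i j, |(d g).1 i j| ≤ M := fun i j => by exact_mod_cast hA i j
  have hc' : ∀ i, |(d g).2 i| ≤ N := fun i => by exact_mod_cast hc i
  exact ⟨⟨fun i j => (abs_le.1 (hA' i j)).1, fun i j => (abs_le.1 (hA' i j)).2⟩,
    ⟨fun i => (abs_le.1 (hc' i)).1, fun i => (abs_le.1 (hc' i)).2⟩⟩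

/-- If the orbit of `Q` comes arbitrarily close to `P`, then `P` is in the orbit. -/
theorem exists_smul_eq (P Q : ProperBody n) (h : ∀ ε > 0, ∃ g : AGLZ n, edist P (g • Q) < ε) :
    ∃ g : AGLZ n, P = g • Q := by
  obtain ⟨c, hc⟩ := P.interior_nonempty
  obtain ⟨r, hr, hrP⟩ := Metric.nhds_basis_closedBall.mem_iff.1 (mem_interior_iff_mem_nhds.1 hc)
  obtain ⟨R, hR⟩ := Q.body.isCompact.isBounded.subset_closedBall 0
  have hfin : {g : AGLZ n | edist P (g • Q) <
      MeasureTheory.volume (Metric.ball (0 : Pt n) (r / 4))}.Finite := by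
    refine ((finite_mapsTo c (half_pos hr) R).preimage (inv_injective.injOn)).subset ?_
    intro g hg
    have h1 := ball_subset_of_edist_lt hr hrP hg
    rintro _ ⟨x, hx, rfl⟩
    obtain ⟨q, hq, rfl⟩ := h1 hx
    have h2 : ((g⁻¹ : AGLZ n) : Pt n ≃ᵃ[ℝ] Pt n) ((g : Pt n ≃ᵃ[ℝ] Pt n) q) = q :=
      (g : Pt n ≃ᵃ[ℝ] Pt n).symm_apply_apply q
    rw [h2]
    exact hR hq
  have hv : 0 < MeasureTheory.volume (Metric.ball (0 : Pt n) (r / 4)) :=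
    Metric.measure_ball_pos _ _ (by positivity)
  obtain ⟨g₀, hg₀⟩ := h _ hv
  obtain ⟨g₁, hg₁, hmin⟩ := hfin.exists_minimalFor (fun g => edist P (g • Q)) _ ⟨g₀, hg₀⟩
  refine ⟨g₁, ?_⟩
  by_contra hne
  obtain ⟨g₂, hg₂⟩ := h _ (edist_pos.2 hne)
  exact absurd (hmin (hg₂.trans hg₁) hg₂.le) (not_le.2 hg₂)

end AGLZ

/-- The set of orbits of proper convex bodies under `AGL(n, ℤ)`. -/
def BodyOrbits (n : ℕ) : Type := MulAction.orbitRel.Quotient (AGLZ n) (ProperBody n)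

namespace BodyOrbits

variable {n : ℕ}

/-- The orbit of a proper convex body. -/
noncomputable def mk (P : ProperBody n) : BodyOrbits n :=
  Quotient.mk (MulAction.orbitRel (AGLZ n) (ProperBody n)) P

theorem exists_rep (x : BodyOrbits n) : ∃ P, mk P = x := Quotient.exists_rep x

theorem mk_eq_mk {P Q : ProperBody n} : mk P = mk Q ↔ ∃ g : AGLZ n, P = g • Q := by
  refine (Quotient.eq (r := MulAction.orbitRel (AGLZ n) (ProperBody n))).trans ?_
  rw [MulAction.orbitRel_apply, MulAction.mem_orbit_iff]
  exact ⟨fun ⟨g, hg⟩ => ⟨g, hg.symm⟩, fun ⟨g, hg⟩ => ⟨g, hg.symm⟩⟩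

/-- The distance between two orbits: the infimum of the distances between their elements. -/
noncomputable instance : EDist (BodyOrbits n) where
  edist x y := ⨅ (P : ProperBody n) (_ : mk P = x) (Q : ProperBody n) (_ : mk Q = y), edist P Q

theorem edist_def (x y : BodyOrbits n) : edist x y =
    ⨅ (P : ProperBody n) (_ : mk P = x) (Q : ProperBody n) (_ : mk Q = y), edist P Q := rfl

theorem edist_mk_le (P Q : ProperBody n) : edist (mk P) (mk Q) ≤ edist P Q :=
  iInf₂_le_of_le P rfl (iInf₂_le_of_le Q rfl le_rfl)

theorem exists_edist_lt {P : ProperBody n} {y : BodyOrbits n} {ε : ENNReal}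
    (h : edist (mk P) y < ε) : ∃ Q, mk Q = y ∧ edist P Q < ε := by
  simp only [edist_def, iInf_lt_iff] at h
  obtain ⟨P', hP', Q', rfl, hlt⟩ := h
  obtain ⟨g, rfl⟩ := mk_eq_mk.1 hP'.symm
  refine ⟨g • Q', mk_eq_mk.2 ⟨g, rfl⟩, ?_⟩
  rwa [AGLZ.edist_smul]

/-- The metric space of the orbits of proper convex bodies under `AGL(n, ℤ)`. -/
noncomputable instance : EMetricSpace (BodyOrbits n) where
  edist_self x := by
    obtain ⟨P, rfl⟩ := exists_rep x
    exact le_antisymm ((edist_mk_le P P).trans (edist_self P).le) (zero_le)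
  edist_comm x y := by
    have key : ∀ x y : BodyOrbits n, edist x y ≤ edist y x := by
      intro x y
      rw [edist_def y x]
      refine le_iInf₂ fun P hP => le_iInf₂ fun Q hQ => ?_
      subst hP hQ
      exact (edist_mk_le Q P).trans (edist_comm Q P).le
    exact (key x y).antisymm (key y x)
  edist_triangle x y z := by
    obtain ⟨P, rfl⟩ := exists_rep x
    refine ENNReal.le_of_forall_pos_le_add fun ε hε hfin => ?_
    have hε' : ((ε / 2 : NNReal) : ENNReal) ≠ 0 := by simpa using hε.ne'
    obtain ⟨h1, h2⟩ := ENNReal.add_lt_top.1 hfin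
    obtain ⟨Q, rfl, hQ⟩ := exists_edist_lt (ENNReal.lt_add_right h1.ne hε')
    obtain ⟨R, rfl, hR⟩ := exists_edist_lt (ENNReal.lt_add_right h2.ne hε')
    calc edist (mk P) (mk R) ≤ edist P R := edist_mk_le P R
      _ ≤ edist P Q + edist Q R := edist_triangle P Q R
      _ ≤ (edist (mk P) (mk Q) + (ε / 2 : NNReal)) + (edist (mk Q) (mk R) + (ε / 2 : NNReal)) :=
        add_le_add hQ.le hR.le
      _ = edist (mk P) (mk Q) + edist (mk Q) (mk R) + ((ε / 2 + ε / 2 : NNReal) : ENNReal) := by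
        push_cast; ring
      _ = _ := by rw [add_halves]
  eq_of_edist_eq_zero := by
    intro x y h
    obtain ⟨P, rfl⟩ := exists_rep x
    obtain ⟨Q, rfl⟩ := exists_rep y
    refine mk_eq_mk.2 (AGLZ.exists_smul_eq P Q fun ε hε => ?_)
    obtain ⟨Q', hQ', hlt⟩ := exists_edist_lt (h.trans_lt hε)
    obtain ⟨g, rfl⟩ := mk_eq_mk.1 hQ'
    exact ⟨g, hlt⟩

end BodyOrbits

/-! ### The spaces of Delzant polytopes -/

/-- The space of Delzant `n`-polytopes, inside the space of convex bodies in `ℝⁿ` with the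
Hausdorff distance. -/
def delzantH (n : ℕ) : Set (ConvexBody (Pt n)) := {P | IsDelzant (P : Set (Pt n))}

/-- The Delzant `n`-polytopes with `m` facets, with the Hausdorff distance. -/
def delzantFacetsH (n m : ℕ) : Set (ConvexBody (Pt n)) :=
  {P | IsDelzant (P : Set (Pt n)) ∧ HasFacets (P : Set (Pt n)) m}

/-- The space of Delzant `n`-polytopes, inside the space of proper convex bodies in `ℝⁿ` with the
symmetric difference distance. -/
def delzantV (n : ℕ) : Set (ProperBody n) := {P | IsDelzant P.toSet}

/-- The Delzant `n`-polytopes with `m` facets, with the symmetric difference distance. -/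
def delzantFacetsV (n m : ℕ) : Set (ProperBody n) := {P | IsDelzant P.toSet ∧ HasFacets P.toSet m}

/-- The quotient of the space of Delzant `n`-polytopes by `AGL(n, ℤ)`. -/
def delzantQuot (n : ℕ) : Set (BodyOrbits n) := BodyOrbits.mk '' delzantV n

/-- The quotient by `AGL(n, ℤ)` of the space of Delzant `n`-polytopes with `m` facets. -/
def delzantFacetsQuot (n m : ℕ) : Set (BodyOrbits n) := BodyOrbits.mk '' delzantFacetsV n m

end Delzant

/-! A Delzant polytope with m facets is cut out by m inequalities ⟨v i, x⟩ ≤ h i with integer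
normals (`exists_eq_poly`). There are only countably many tuples v, and for a fixed v the polytope
has m real parameters h. The dimension is m because h and the body control each other in a Lipschitz
way.

Upper bound: if two polyhedra with the same normals contain balls of radius r and lie in a ball of
radius R, each lies in a slight dilation of the other. Hence both distances are at most a constant
times the distance of the right hand sides, and countably many classes (v, r, R) cover everything
(`dimH_le_of_poly`). The orbit map is 1-Lipschitz, so the quotient inherits the bound.

Lower bound: take one polytope in which every constraint is needed (`IsIrredundant`) and the active
normals at each point have an integer dual system (`IsSmooth`). Both conditions are open in h, so a
whole ball in ℝᵐ parametrizes Delzant polytopes with m facets. On a small ball, distances of bodies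
bound distances of parameters from below: `edist_le_mul_edist_convexBody` for δ^H,
`exists_edist_le_mul_edist` for δ^V. In the quotient, orbits are discrete and stabilizers finite;
near a parameter whose stabilizer has least order, small orbit distances equal distances of bodies
(`exists_edist_mk_eq`). The lower bound for δ^V follows from the one for the quotient.

The polytope to start from is a truncated simplex, the region x ≥ 0 with x₀ ≤ min_i (c i + (i - 1)
s). The heights c i make this minimum a concave function of s with one break at each of s = 1, …, J.
Since all m occur inside 𝒟(n), its dimension is infinite. -/

namespace Delzant

open MeasureTheory Metric Topology Filter
open scoped ENNReal NNReal

/-! ### Polyhedra given by inequalities -/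

/-- The polyhedron `{x | ⟨w i, x⟩ ≤ h i for all i}`. -/
def poly {n : ℕ} {ι : Type*} (w : ι → Pt n) (h : ι → ℝ) : Set (Pt n) :=
  {x | ∀ i, inner ℝ (w i) x ≤ h i}

section Poly

variable {n : ℕ} {ι : Type*} {w : ι → Pt n} {h h' : ι → ℝ}

theorem convex_poly : Convex ℝ (poly w h) := by
  have : poly w h = ⋂ i, {x | inner ℝ (w i) x ≤ h i} := by ext; simp [poly]
  rw [this]
  exact convex_iInter fun i => convex_halfSpace_le
    ⟨fun x y => inner_add_right _ _ _, fun c x => real_inner_smul_right _ _ _⟩ _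

theorem isClosed_poly : IsClosed (poly w h) := by
  have : poly w h = ⋂ i, {x | inner ℝ (w i) x ≤ h i} := by ext; simp [poly]
  rw [this]
  exact isClosed_iInter fun i => isClosed_le (by fun_prop) continuous_const

theorem poly_mono (hh : h ≤ h') : poly w h ⊆ poly w h' := fun _ hx i => (hx i).trans (hh i)

/-- The slack of a constraint at the centre of an inscribed ball. -/
theorem add_radius_le_of_closedBall_subset {c : Pt n} {r : ℝ} (hr : 0 ≤ r) {i : ι}
    (hw : 1 ≤ ‖w i‖) (hc : closedBall c r ⊆ poly w h) : inner ℝ (w i) c + r ≤ h i := by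
  have hpos : 0 < ‖w i‖ := by linarith
  have h1 := hc (a := c + (r / ‖w i‖) • w i) (by
    rw [mem_closedBall_iff_norm, add_sub_cancel_left, norm_smul, Real.norm_of_nonneg (by positivity)]
    field_simp; exact le_rfl) i
  rw [inner_add_right, real_inner_smul_right, real_inner_self_eq_norm_sq] at h1
  have h2 : r / ‖w i‖ * ‖w i‖ ^ 2 = r * ‖w i‖ := by field_simp
  nlinarith

/-- A polyhedron with perturbed right hand sides is contained in a slight dilation. -/
theorem homothety_inv_mem_poly {c x : Pt n} {r δ : ℝ} (hr : 0 < r) (hδ : 0 ≤ δ)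
    (hw : ∀ i, 1 ≤ ‖w i‖) (hc : closedBall c r ⊆ poly w h) (hh : ∀ i, h' i ≤ h i + δ)
    (hx : x ∈ poly w h') : AffineMap.homothety c (1 + δ / r)⁻¹ x ∈ poly w h := by
  intro i
  have h1 := add_radius_le_of_closedBall_subset hr.le (hw i) hc
  have ht : 0 < 1 + δ / r := by positivity
  have h2 : inner ℝ (w i) x - inner ℝ (w i) c ≤ (1 + δ / r) * (h i - inner ℝ (w i) c) := by
    have h3 := hx i
    have h4 := hh i
    -- Every constraint has slack at least r at c, so dilating by 1 + δ / r relaxes it by at least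
    -- δ.
    have h5 : δ ≤ δ / r * (h i - inner ℝ (w i) c) := by
      calc δ = δ / r * r := by field_simp
        _ ≤ _ := by gcongr; linarith
    nlinarith
  rw [AffineMap.homothety_apply, vsub_eq_sub, vadd_eq_add, inner_add_right, real_inner_smul_right,
    inner_sub_right]
  have h6 : (1 + δ / r)⁻¹ * (inner ℝ (w i) x - inner ℝ (w i) c) ≤ h i - inner ℝ (w i) c := by
    rw [inv_mul_le_iff₀ ht]; exact h2
  linarith

theorem exists_dist_le_of_mem_poly {c x : Pt n} {r R δ : ℝ} (hr : 0 < r) (hδ : 0 ≤ δ)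
    (hw : ∀ i, 1 ≤ ‖w i‖) (hc : closedBall c r ⊆ poly w h) (hh : ∀ i, h' i ≤ h i + δ)
    (hR : poly w h ⊆ closedBall 0 R) (hR' : poly w h' ⊆ closedBall 0 R)
    (hx : x ∈ poly w h') : ∃ y ∈ poly w h, dist x y ≤ 2 * R / r * δ := by
  refine ⟨_, homothety_inv_mem_poly hr hδ hw hc hh hx, ?_⟩
  have h1 := hR' hx
  have h2 := hR (hc (mem_closedBall_self hr.le))
  rw [mem_closedBall_zero_iff] at h1 h2
  have ht : 0 < 1 + δ / r := by positivity
  have h3 : x - AffineMap.homothety c (1 + δ / r)⁻¹ x = (δ / r / (1 + δ / r)) • (x - c) := by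
    rw [AffineMap.homothety_apply, vsub_eq_sub, vadd_eq_add]
    have : δ / r / (1 + δ / r) = 1 - (1 + δ / r)⁻¹ := by field_simp; ring
    rw [this, sub_smul, one_smul]; abel
  rw [dist_eq_norm, h3, norm_smul, Real.norm_of_nonneg (by positivity)]
  have h4 : δ / r / (1 + δ / r) ≤ δ / r := div_le_self (by positivity) (by
    have : 0 ≤ δ / r := by positivity
    linarith)
  have h5 : ‖x - c‖ ≤ 2 * R := (norm_sub_le _ _).trans (by linarith)
  calc _ ≤ δ / r * (2 * R) := by gcongr
    _ = _ := by ring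

/-- The left side is convex in t and vanishes at 0, so on [0, 1] it lies below its chord. -/
theorem one_add_pow_le {t : ℝ} (h0 : 0 ≤ t) (h1 : t ≤ 1) (n : ℕ) :
    (1 + t) ^ n - 1 ≤ (2 ^ n - 1) * t := by
  induction n with
  | zero => simp
  | succ k ih =>
    have h2 : (0 : ℝ) ≤ 2 ^ k - 1 := by
      have := one_le_pow₀ (one_le_two (α := ℝ)) (n := k)
      linarith
    rw [pow_succ, pow_succ]
    nlinarith [mul_nonneg (mul_nonneg h2 h0) (sub_nonneg.2 h1), mul_nonneg h2 h0]

/-- The larger polyhedron lies in the dilation of the smaller one by 1 + δ / r about c, whose volume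
is known exactly. For δ > r the bound by the volume of the whole ball suffices. -/
theorem volume_poly_diff_le {c : Pt n} {r R δ : ℝ} (hr : 0 < r) (hδ : 0 ≤ δ)
    (hw : ∀ i, 1 ≤ ‖w i‖) (hc : closedBall c r ⊆ poly w h) (hh : ∀ i, h' i ≤ h i + δ)
    (hR : poly w h ⊆ closedBall 0 R) (hR' : poly w h' ⊆ closedBall 0 R) :
    volume (poly w h' \ poly w h) ≤
      ENNReal.ofReal (2 ^ n / r * δ) * volume (closedBall (0 : Pt n) R) := by
  set t := δ / r with ht
  have ht0 : 0 ≤ t := by positivity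
  have hpow : (1 : ℝ) ≤ 2 ^ n := one_le_pow₀ one_le_two
  have hrw : 2 ^ n / r * δ = 2 ^ n * t := by rw [ht]; ring
  rw [hrw]
  rcases le_total t 1 with h1 | h1
  · have hpos : 0 < 1 + t := by positivity
    have hsub : poly w h' \ poly w h ⊆
        (AffineMap.homothety c (1 + t) '' poly w h) \ poly w h := by
      refine Set.sdiff_subset_sdiff_left fun x hx => ⟨_, homothety_inv_mem_poly hr hδ hw hc hh hx, ?_⟩
      rw [← AffineMap.homothety_mul_apply, mul_inv_cancel₀ hpos.ne', AffineMap.homothety_one]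
      rfl
    have hsub2 : poly w h ⊆ AffineMap.homothety c (1 + t) '' poly w h := fun x hx => by
      refine ⟨_, homothety_inv_mem_poly (h' := h) hr hδ hw hc (fun i => by linarith) hx, ?_⟩
      rw [← AffineMap.homothety_mul_apply, mul_inv_cancel₀ hpos.ne', AffineMap.homothety_one]
      rfl
    have hfin : volume (poly w h) ≠ ∞ :=
      (measure_mono hR).trans_lt measure_closedBall_lt_top |>.ne
    calc _ ≤ _ := measure_mono hsub
      _ = ENNReal.ofReal ((1 + t) ^ n) * volume (poly w h) - 1 * volume (poly w h) := by
        rw [measure_sdiff hsub2 isClosed_poly.measurableSet.nullMeasurableSet hfin,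
          Measure.addHaar_image_homothety, finrank_euclideanSpace, Fintype.card_fin,
          abs_of_nonneg (by positivity), one_mul]
      _ = ENNReal.ofReal ((1 + t) ^ n - 1) * volume (poly w h) := by
        rw [← ENNReal.sub_mul (fun _ _ => hfin), ENNReal.ofReal_sub _ zero_le_one,
          ENNReal.ofReal_one]
      _ ≤ _ := by
        refine mul_le_mul' (ENNReal.ofReal_le_ofReal ?_) (measure_mono hR)
        have := one_add_pow_le ht0 h1 n
        linarith
  · calc _ ≤ volume (closedBall (0 : Pt n) R) := measure_mono (Set.sdiff_subset.trans hR')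
      _ = 1 * volume (closedBall (0 : Pt n) R) := (one_mul _).symm
      _ ≤ _ := by
        refine mul_le_mul' ?_ le_rfl
        rw [← ENNReal.ofReal_one]
        exact ENNReal.ofReal_le_ofReal (by nlinarith)

variable [Fintype ι]

theorem le_add_dist (h h' : ι → ℝ) (i : ι) : h' i ≤ h i + dist h h' := by
  have h1 := dist_le_pi_dist h h' i
  rw [Real.dist_eq] at h1
  linarith [neg_abs_le (h i - h' i)]

theorem convexBody_dist_le_of_eq_poly {K L : ConvexBody (Pt n)} {c c' : Pt n} {r R : ℝ} (hr : 0 < r)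
    (hw : ∀ i, 1 ≤ ‖w i‖) (hK : (K : Set (Pt n)) = poly w h) (hL : (L : Set (Pt n)) = poly w h')
    (hc : closedBall c r ⊆ poly w h) (hc' : closedBall c' r ⊆ poly w h')
    (hR : poly w h ⊆ closedBall 0 R) (hR' : poly w h' ⊆ closedBall 0 R) :
    dist K L ≤ 2 * R / r * dist h h' := by
  have hR0 : 0 ≤ R := by
    have := hR (hc (mem_closedBall_self hr.le))
    rw [mem_closedBall_zero_iff] at this
    exact (norm_nonneg _).trans this
  rw [← ConvexBody.hausdorffDist_coe, hK, hL]
  refine hausdorffDist_le_of_mem_dist (by positivity) ?_ ?_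
  · intro x hx
    exact exists_dist_le_of_mem_poly hr dist_nonneg hw hc'
      (fun i => by rw [dist_comm]; exact le_add_dist h' h i) hR' hR hx
  · intro x hx
    exact exists_dist_le_of_mem_poly hr dist_nonneg hw hc (le_add_dist h h') hR hR' hx

/-- A Lipschitz constant for the symmetric difference distance in terms of the right hand sides. -/
noncomputable def volLip (n : ℕ) (r R : ℝ) : ℝ≥0 :=
  2 * ((2 ^ n / r).toNNReal * (volume (closedBall (0 : Pt n) R)).toNNReal)

theorem ProperBody.edist_le_of_eq_poly {K L : ProperBody n} {c c' : Pt n} {r R : ℝ} (hr : 0 < r)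
    (hw : ∀ i, 1 ≤ ‖w i‖) (hK : K.toSet = poly w h) (hL : L.toSet = poly w h')
    (hc : closedBall c r ⊆ poly w h) (hc' : closedBall c' r ⊆ poly w h')
    (hR : poly w h ⊆ closedBall 0 R) (hR' : poly w h' ⊆ closedBall 0 R) :
    edist K L ≤ volLip n r R * edist h h' := by
  have h1 := volume_poly_diff_le hr (dist_nonneg (x := h) (y := h')) hw hc (le_add_dist h h') hR hR'
  have h2 := volume_poly_diff_le hr (dist_nonneg (x := h) (y := h')) hw hc'
    (fun i => by rw [dist_comm]; exact le_add_dist h' h i) hR' hR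
  rw [ProperBody.edist_def, hK, hL]
  refine (add_le_add h2 h1).trans (le_of_eq ?_)
  rw [volLip, edist_dist, ENNReal.ofReal_mul (by positivity)]
  push_cast
  rw [ENNReal.coe_toNNReal measure_closedBall_lt_top.ne, ← ENNReal.ofReal.eq_1]
  ring

end Poly

/-! ### Hausdorff dimension under maps that do not contract too much -/

theorem dimH_le_dimH_image_of_edist_le {X Y : Type*} [EMetricSpace X] [EMetricSpace Y] {K : ℝ≥0}
    {f : X → Y} {s : Set X} (hf : ∀ x ∈ s, ∀ y ∈ s, edist x y ≤ K * edist (f x) (f y)) :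
    dimH s ≤ dimH (f '' s) := by
  have h1 : AntilipschitzWith K (fun x : s => f x) := fun x y => hf x x.2 y y.2
  have h2 := h1.le_dimH_image Set.univ
  rw [← isometry_subtype_coe.dimH_image, Set.image_univ, Subtype.range_coe] at h2
  refine h2.trans (dimH_mono ?_)
  rintro _ ⟨x, -, rfl⟩
  exact ⟨x, x.2, rfl⟩

theorem dimH_le_card_of_edist_le {X ι : Type*} [EMetricSpace X] [Fintype ι] {K : ℝ≥0}
    {f : X → ι → ℝ} {s : Set X} (hf : ∀ x ∈ s, ∀ y ∈ s, edist x y ≤ K * edist (f x) (f y)) :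
    dimH s ≤ Fintype.card ι :=
  (dimH_le_dimH_image_of_edist_le hf).trans
    ((dimH_mono (Set.subset_univ _)).trans (Real.dimH_univ_pi ι).le)

/-! ### Integer vectors and dual systems -/

section IntPt

variable {n : ℕ}

theorem inner_intPt (u : Fin n → ℤ) (x : Pt n) : inner ℝ (intPt u) x = ∑ j, (u j : ℝ) * x j := by
  simp [intPt, PiLp.inner_apply, mul_comm]

theorem inner_intPt_intPt (u v : Fin n → ℤ) :
    inner ℝ (intPt u) (intPt v) = ((u ⬝ᵥ v : ℤ) : ℝ) := by
  rw [inner_intPt]; simp [intPt, dotProduct]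

theorem intPt_injective : Function.Injective (intPt : (Fin n → ℤ) → Pt n) := by
  intro u v h
  ext j
  have := congrArg (fun x : Pt n => x j) h
  simpa [intPt] using this

theorem intPt_sum_smul {κ : Type*} (s : Finset κ) (a : κ → ℤ) (v : κ → Fin n → ℤ) :
    intPt (∑ i ∈ s, a i • v i) = ∑ i ∈ s, (a i : ℝ) • intPt (v i) := by
  ext j
  simp [intPt]

theorem intPt_ne_zero {u : Fin n → ℤ} (hu : u ≠ 0) : intPt u ≠ 0 := fun h =>
  hu (intPt_injective (h.trans (by ext; simp [intPt])))

theorem one_le_norm_intPt {u : Fin n → ℤ} (hu : u ≠ 0) : 1 ≤ ‖intPt u‖ := by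
  have h1 : (1 : ℤ) ≤ u ⬝ᵥ u := by
    have h0 : 0 ≤ u ⬝ᵥ u := Finset.sum_nonneg fun j _ => mul_self_nonneg _
    have : u ⬝ᵥ u ≠ 0 := fun h => hu (dotProduct_self_eq_zero.1 h)
    omega
  have h2 : (1 : ℝ) ≤ ‖intPt u‖ ^ 2 := by
    rw [← real_inner_self_eq_norm_sq, inner_intPt_intPt]; exact_mod_cast h1
  nlinarith [norm_nonneg (intPt u)]

end IntPt

section Dual

variable {n : ℕ} {κ : Type*} {v : κ → Fin n → ℤ} {I : Set κ} {u : κ → Fin n → ℤ}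

/-- The integer vectors `u i` are dual to the integer vectors `v i`, for `i ∈ I`. -/
def IsDualOn (v u : κ → Fin n → ℤ) (I : Set κ) : Prop :=
  (∀ i ∈ I, u i ⬝ᵥ v i = 1) ∧ ∀ i ∈ I, ∀ j ∈ I, i ≠ j → u i ⬝ᵥ v j = 0

theorem IsDualOn.mono (hu : IsDualOn v u I) {J : Set κ} (hJ : J ⊆ I) : IsDualOn v u J :=
  ⟨fun i hi => hu.1 i (hJ hi), fun i hi j hj => hu.2 i (hJ hi) j (hJ hj)⟩

theorem IsDualOn.inner_self (hu : IsDualOn v u I) {i : κ} (hi : i ∈ I) :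
    inner ℝ (intPt (u i)) (intPt (v i)) = 1 := by
  rw [inner_intPt_intPt, hu.1 i hi]; simp

theorem IsDualOn.inner_of_ne (hu : IsDualOn v u I) {i j : κ} (hi : i ∈ I) (hj : j ∈ I)
    (hij : i ≠ j) : inner ℝ (intPt (u i)) (intPt (v j)) = 0 := by
  rw [inner_intPt_intPt, hu.2 i hi j hj hij]; simp

theorem IsDualOn.inner_sum {s : Finset κ} (hu : IsDualOn v u s) {i : κ} (hi : i ∈ s)
    (a : κ → ℝ) : inner ℝ (intPt (u i)) (∑ j ∈ s, a j • intPt (v j)) = a i := by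
  rw [_root_.inner_sum, Finset.sum_eq_single i]
  · rw [real_inner_smul_right, hu.inner_self hi, mul_one]
  · intro j hj hji
    rw [real_inner_smul_right, hu.inner_of_ne hi hj hji.symm, mul_zero]
  · exact fun h => absurd hi h

/-- Pairing with u i reads off the coefficient of v i. This gives linear independence, integrality
of the coefficients of a lattice point in the span, and primitivity, since the gcd of the entries of
v i divides u i ⬝ᵥ v i = 1. -/
theorem isUnimodularCone_of_isDualOn {k : ℕ} {v u : Fin k → Fin n → ℤ}
    (hu : IsDualOn v u Set.univ) : IsUnimodularCone (coneGen fun i => intPt (v i)) := by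
  have hu' : IsDualOn v u (Finset.univ : Finset (Fin k)) := by simpa using hu
  refine ⟨k, v, fun i => ?_, ?_, rfl, fun w hw => ?_⟩
  · have h1 : Finset.univ.gcd (v i) ∣ 1 := by
      rw [← hu.1 i trivial]
      exact Finset.dvd_sum fun j _ => (Finset.gcd_dvd (Finset.mem_univ j)).mul_left _
    rw [← Finset.normalize_gcd, normalize_eq_one]
    exact isUnit_of_dvd_one h1
  · rw [Fintype.linearIndependent_iff]
    intro g hg i
    rw [← hu'.inner_sum (Finset.mem_univ i) g, hg, inner_zero_right]
  · rw [Submodule.mem_span_range_iff_exists_fun] at hw ⊢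
    obtain ⟨c, hc⟩ := hw
    refine ⟨fun i => u i ⬝ᵥ w, intPt_injective ?_⟩
    rw [intPt_sum_smul, ← hc]
    refine Finset.sum_congr rfl fun i _ => ?_
    rw [← inner_intPt_intPt, ← hc, hu'.inner_sum (Finset.mem_univ i)]

theorem isUnimodularCone_of_isDualOn_finset {s : Finset κ} (hu : IsDualOn v u s) :
    IsUnimodularCone {x | ∃ a : κ → ℝ, (∀ i, 0 ≤ a i) ∧ x = ∑ i ∈ s, a i • intPt (v i)} := by
  set e := s.equivFin with he
  have hd : IsDualOn (fun j => v (e.symm j)) (fun j => u (e.symm j)) Set.univ :=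
    ⟨fun j _ => hu.1 _ (e.symm j).2, fun j _ k _ hjk =>
      hu.2 _ (e.symm j).2 _ (e.symm k).2 fun h => hjk (e.symm.injective (Subtype.ext h))⟩
  have hsum : ∀ a : κ → ℝ, ∑ i ∈ s, a i • intPt (v i) =
      ∑ j, a (e.symm j) • intPt (v (e.symm j)) := fun a => by
    rw [← Finset.sum_coe_sort s]
    exact (Equiv.sum_comp e.symm (fun i : s => a i • intPt (v i))).symm
  convert isUnimodularCone_of_isDualOn hd using 1
  ext x
  constructor
  · rintro ⟨a, ha, rfl⟩
    exact ⟨fun j => a (e.symm j), fun j => ha _, hsum a⟩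
  · rintro ⟨a, ha, rfl⟩
    classical
    refine ⟨fun i => if h : i ∈ s then a (e ⟨i, h⟩) else 0, fun i => ?_, ?_⟩
    · dsimp only
      split_ifs
      exacts [ha _, le_rfl]
    · rw [hsum]
      simp

end Dual

/-! ### Active constraints and normal cones -/

section Active

variable {n : ℕ} {ι : Type*} [Fintype ι] {w : ι → Pt n} {h : ι → ℝ}

open Classical in
/-- The constraints of a polyhedron that hold with equality at `x`. -/
noncomputable def active (w : ι → Pt n) (h : ι → ℝ) (x : Pt n) : Finset ι :=
  Finset.univ.filter fun i => inner ℝ (w i) x = h i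

theorem mem_active {x : Pt n} {i : ι} : i ∈ active w h x ↔ inner ℝ (w i) x = h i := by
  simp [active]

/-- A direction that does not increase the active constraints is feasible for small steps. -/
theorem exists_pos_add_smul_mem_poly {x d : Pt n} (hx : x ∈ poly w h)
    (hd : ∀ i ∈ active w h x, inner ℝ (w i) d ≤ 0) : ∃ ε > (0 : ℝ), x + ε • d ∈ poly w h := by
  have h1 : ∀ᶠ ε in 𝓝[>] (0 : ℝ), ∀ i, inner ℝ (w i) (x + ε • d) ≤ h i := by
    refine eventually_all.2 fun i => ?_
    by_cases hi : i ∈ active w h x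
    · filter_upwards [self_mem_nhdsWithin] with ε hε
      rw [inner_add_right, real_inner_smul_right, mem_active.1 hi]
      have := mul_nonpos_of_nonneg_of_nonpos (le_of_lt hε) (hd i hi)
      linarith
    · have hlt : inner ℝ (w i) (x + (0 : ℝ) • d) < h i := by
        rw [zero_smul, add_zero]
        exact lt_of_le_of_ne (hx i) (fun h => hi (mem_active.2 h))
      have hc : Continuous fun ε : ℝ => inner ℝ (w i) (x + ε • d) := by fun_prop
      exact ((hc.tendsto 0).eventually_lt_const hlt).filter_mono nhdsWithin_le_nhds |>.mono
        fun _ h => h.le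
  obtain ⟨ε, hε, h2⟩ := (h1.and self_mem_nhdsWithin).exists
  exact ⟨ε, h2, hε⟩

theorem inner_le_zero_of_feasible {x d α : Pt n} (hx : x ∈ poly w h)
    (hα : ∀ y ∈ poly w h, inner ℝ α y ≤ inner ℝ α x)
    (hd : ∀ i ∈ active w h x, inner ℝ (w i) d ≤ 0) : inner ℝ α d ≤ 0 := by
  obtain ⟨ε, hε, hmem⟩ := exists_pos_add_smul_mem_poly hx hd
  have h1 := hα _ hmem
  rw [inner_add_right, real_inner_smul_right] at h1
  nlinarith

/-- Farkas' lemma at a point where the active normals have a dual system. -/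
theorem exists_nonneg_combination {v u : ι → Fin n → ℤ} {x α : Pt n}
    (hu : IsDualOn v u (active (fun i => intPt (v i)) h x))
    (hx : x ∈ poly (fun i => intPt (v i)) h)
    (hα : ∀ y ∈ poly (fun i => intPt (v i)) h, inner ℝ α y ≤ inner ℝ α x) :
    ∃ a : ι → ℝ, (∀ i, 0 ≤ a i) ∧
      α = ∑ i ∈ active (fun i => intPt (v i)) h x, a i • intPt (v i) := by
  classical
  set I := active (fun i => intPt (v i)) h x with hI
  have hnn : ∀ i ∈ I, 0 ≤ inner ℝ α (intPt (u i)) := by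
    intro i hi
    -- Moving along -u i leaves the constraint i and keeps the other active ones tight.
    have h1 := inner_le_zero_of_feasible (d := -intPt (u i)) hx hα (by
      intro j hj
      rw [inner_neg_right, real_inner_comm]
      by_cases hij : i = j
      · subst hij; rw [hu.inner_self hj]; norm_num
      · rw [hu.inner_of_ne hi hj hij]; norm_num)
    rw [inner_neg_right] at h1
    linarith
  set a : ι → ℝ := fun i => if i ∈ I then inner ℝ α (intPt (u i)) else 0 with ha
  have ha0 : ∀ i, 0 ≤ a i := by
    intro i
    simp only [ha]
    split_ifs with hi
    exacts [hnn i hi, le_rfl]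
  refine ⟨a, ha0, ?_⟩
  -- The residual β is orthogonal to all u j; its correction d by multiples of the u j is orthogonal
  -- to all active v k. Both d and -d are then feasible, so ⟨α, d⟩ = 0, and this number equals ⟨β,
  -- d⟩ = ‖β‖².
  set β := α - ∑ i ∈ I, a i • intPt (v i) with hβ
  have hβu : ∀ j ∈ I, inner ℝ (intPt (u j)) β = 0 := by
    intro j hj
    rw [hβ, inner_sub_right, hu.inner_sum hj, real_inner_comm]
    simp [ha, hj]
  set d := β - ∑ j ∈ I, (inner ℝ (intPt (v j)) β : ℝ) • intPt (u j) with hd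
  have hwd : ∀ k ∈ I, inner ℝ (intPt (v k)) d = 0 := by
    intro k hk
    rw [hd, inner_sub_right, inner_sum, Finset.sum_eq_single k]
    · rw [real_inner_smul_right, real_inner_comm (intPt (u k)), hu.inner_self hk, mul_one, sub_self]
    · intro j hj hjk
      rw [real_inner_smul_right, real_inner_comm (intPt (u j)), hu.inner_of_ne hj hk hjk,
        mul_zero]
    · exact fun h => absurd hk h
  have h1 := inner_le_zero_of_feasible (d := d) hx hα fun i hi => (hwd i hi).le
  have h2 := inner_le_zero_of_feasible (d := -d) hx hα fun i hi => by
    rw [inner_neg_right]; exact (neg_eq_zero.2 (hwd i hi)).le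
  rw [inner_neg_right] at h2
  have h3 : inner ℝ β d = 0 := by
    conv_lhs => rw [hβ]
    rw [inner_sub_left, sum_inner, Finset.sum_eq_zero, sub_zero]
    · linarith
    · intro i hi
      rw [real_inner_smul_left, hwd i hi, mul_zero]
  have h4 : inner ℝ β d = ‖β‖ ^ 2 := by
    conv_lhs => rw [hd]
    rw [inner_sub_right, inner_sum, Finset.sum_eq_zero, sub_zero, real_inner_self_eq_norm_sq]
    intro i hi
    rw [real_inner_smul_right, real_inner_comm (intPt (u i)) β, hβu i hi, mul_zero]
  have h5 : β = 0 := by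
    rw [h3] at h4
    exact norm_eq_zero.1 (pow_eq_zero_iff (two_ne_zero)|>.1 h4.symm)
  exact sub_eq_zero.1 h5

theorem faceDir_nonempty {P : Set (Pt n)} (hP : IsCompact P) (hne : P.Nonempty) (α : Pt n) :
    (faceDir P α).Nonempty := by
  obtain ⟨x, hx, hmax⟩ := hP.exists_isMaxOn hne (f := fun x => inner ℝ α x) (by fun_prop)
  exact ⟨x, hx, fun y hy => hmax hy⟩

theorem convex_faceDir {P : Set (Pt n)} (hP : Convex ℝ P) (α : Pt n) :
    Convex ℝ (faceDir P α) := by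
  intro x hx y hy a b ha hb hab
  refine ⟨hP hx.1 hy.1 ha hb hab, fun z hz => ?_⟩
  rw [inner_add_right, real_inner_smul_right, real_inner_smul_right]
  have h1 := mul_le_mul_of_nonneg_left (hx.2 z hz) ha
  have h2 := mul_le_mul_of_nonneg_left (hy.2 z hz) hb
  have h3 : inner ℝ α z = a * inner ℝ α z + b * inner ℝ α z := by rw [← add_mul, hab, one_mul]
  linarith

/-- A convex subset of a polyhedron has a point with the smallest set of active constraints. -/
theorem exists_forall_active_subset {F : Set (Pt n)} (hF : Convex ℝ F) (hne : F.Nonempty)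
    (hsub : F ⊆ poly w h) : ∃ x ∈ F, ∀ y ∈ F, active w h x ⊆ active w h y := by
  classical
  obtain ⟨x, hx, hmin⟩ := exists_minimalFor_of_wellFoundedLT (· ∈ F)
    (fun x => (active w h x).card) hne
  refine ⟨x, hx, fun y hy => ?_⟩
  -- A constraint is tight at the midpoint only if it is tight at both ends.
  set z := (1 / 2 : ℝ) • x + (1 / 2 : ℝ) • y with hz
  have hzF : z ∈ F := hF hx hy (by norm_num) (by norm_num) (by norm_num)
  have hsub' : active w h z ⊆ active w h x ∩ active w h y := by
    intro i hi
    have h1 := mem_active.1 hi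
    rw [hz, inner_add_right, real_inner_smul_right, real_inner_smul_right] at h1
    have hx' := hsub hx i
    have hy' := hsub hy i
    rw [Finset.mem_inter, mem_active, mem_active]
    constructor <;> linarith
  have hzx : active w h z = active w h x := by
    refine Finset.eq_of_subset_of_card_le (hsub'.trans Finset.inter_subset_left) ?_
    by_contra hlt
    exact absurd (hmin hzF (not_le.1 hlt).le) hlt
  rw [← hzx]
  exact hsub'.trans Finset.inter_subset_right

variable {v : ι → Fin n → ℤ}

/-- At every point of the polyhedron the active normals have an integer dual system. -/
def IsSmooth (v : ι → Fin n → ℤ) (h : ι → ℝ) : Prop :=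
  ∀ x ∈ poly (fun i => intPt (v i)) h, ∃ u, IsDualOn v u (active (fun i => intPt (v i)) h x)

/-- Farkas' lemma at x gives one inclusion. Conversely, the constraints active at x are active on
the whole face, so their nonnegative combinations are maximal there. -/
theorem normalCone_faceDir_eq (hs : IsSmooth v h) {α x : Pt n}
    (hx : x ∈ faceDir (poly (fun i => intPt (v i)) h) α)
    (hmin : ∀ y ∈ faceDir (poly (fun i => intPt (v i)) h) α,
      active (fun i => intPt (v i)) h x ⊆ active (fun i => intPt (v i)) h y) :
    normalCone (poly (fun i => intPt (v i)) h) (faceDir (poly (fun i => intPt (v i)) h) α) =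
      {β | ∃ a : ι → ℝ, (∀ i, 0 ≤ a i) ∧
        β = ∑ i ∈ active (fun i => intPt (v i)) h x, a i • intPt (v i)} := by
  obtain ⟨u, hu⟩ := hs x hx.1
  ext β
  constructor
  · intro hβ
    exact exists_nonneg_combination hu hx.1 (hβ hx).2
  · rintro ⟨a, ha, rfl⟩ y hy
    refine ⟨hy.1, fun z hz => ?_⟩
    simp only [sum_inner, real_inner_smul_left]
    refine Finset.sum_le_sum fun i hi => mul_le_mul_of_nonneg_left ?_ (ha i)
    rw [mem_active.1 (hmin y hy hi)]
    exact hz i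

theorem isUnimodularCone_of_mem_normalFan (hs : IsSmooth v h)
    (hc : IsCompact (poly (fun i => intPt (v i)) h))
    (hne : (poly (fun i => intPt (v i)) h).Nonempty) {C : Set (Pt n)}
    (hC : C ∈ normalFan (poly (fun i => intPt (v i)) h)) : IsUnimodularCone C := by
  obtain ⟨_, ⟨α, rfl⟩, rfl⟩ := hC
  obtain ⟨x, hx, hmin⟩ := exists_forall_active_subset (convex_faceDir convex_poly α)
    (faceDir_nonempty hc hne α) (fun _ hy => hy.1)
  obtain ⟨u, hu⟩ := hs x hx.1
  rw [normalCone_faceDir_eq hs hx hmin]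
  exact isUnimodularCone_of_isDualOn_finset hu

/-- A point of a polyhedron is extreme only if it is determined by its active constraints. -/
theorem finite_extremePoints_poly : (Set.extremePoints ℝ (poly w h)).Finite := by
  refine Set.Finite.of_finite_image (f := active w h) (Set.toFinite _) ?_
  intro x hx y hy hxy
  by_contra hne
  have hd : ∀ i ∈ active w h x, inner ℝ (w i) (y - x) = 0 := by
    intro i hi
    have h1 := mem_active.1 hi
    have h2 := mem_active.1 (hxy ▸ hi)
    rw [inner_sub_right, h1, h2, sub_self]
  -- With equal active sets, the segment from y to x extends beyond x inside the polyhedron, so x is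
  -- not extreme.
  obtain ⟨ε, hε, h1⟩ := exists_pos_add_smul_mem_poly hx.1 (d := -(y - x)) fun i hi => by
    rw [inner_neg_right, hd i hi, neg_zero]
  have h3 : x ∈ openSegment ℝ (x + ε • -(y - x)) y := by
    have hpos : 0 < 1 + ε := by linarith
    refine ⟨1 / (1 + ε), ε / (1 + ε), by positivity, by positivity, by field_simp, ?_⟩
    have h4 : (1 + ε) • ((1 / (1 + ε)) • (x + ε • -(y - x)) + (ε / (1 + ε)) • y) =
        (1 + ε) • x := by
      rw [smul_add, smul_smul, smul_smul, mul_div_cancel₀ _ hpos.ne', mul_div_cancel₀ _ hpos.ne']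
      module
    exact (smul_right_injective _ hpos.ne') h4
  exact hne (((mem_extremePoints.1 hx).2 _ h1 _ hy.1 h3).2).symm

theorem isFullDimPolytope_poly (hc : IsCompact (poly w h)) (hi : (interior (poly w h)).Nonempty) :
    IsFullDimPolytope (poly w h) := by
  refine ⟨⟨(finite_extremePoints_poly (w := w) (h := h)).toFinset, ?_⟩, ?_⟩
  · rw [Set.Finite.coe_toFinset]
    conv_lhs => rw [← closure_convexHull_extremePoints hc convex_poly]
    exact (finite_extremePoints_poly.isClosed_convexHull ℝ).closure_eq
  · exact top_le_iff.1 ((isOpen_interior.affineSpan_eq_top hi).ge.trans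
      (affineSpan_mono ℝ interior_subset))

theorem isDelzant_poly (hs : IsSmooth v h) (hc : IsCompact (poly (fun i => intPt (v i)) h))
    (hi : (interior (poly (fun i => intPt (v i)) h)).Nonempty) :
    IsDelzant (poly (fun i => intPt (v i)) h) :=
  ⟨isFullDimPolytope_poly hc hi, fun _ hC =>
    isUnimodularCone_of_mem_normalFan hs hc (hi.mono interior_subset) hC⟩

end Active

/-! ### Facets of smooth irredundant polyhedra -/

section Facets

variable {n : ℕ} {ι : Type*} [Fintype ι] {v : ι → Fin n → ℤ} {h : ι → ℝ}

/-- Every constraint is the only active one at some point of the polyhedron. -/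
def IsIrredundant (v : ι → Fin n → ℤ) (h : ι → ℝ) : Prop :=
  ∀ i, ∃ p : Pt n, inner ℝ (intPt (v i)) p = h i ∧ ∀ j, j ≠ i → inner ℝ (intPt (v j)) p < h j

theorem mem_poly_of_facet_point {ι : Type*} {v : ι → Fin n → ℤ} {h : ι → ℝ} {i : ι} {p : Pt n} (hp : inner ℝ (intPt (v i)) p = h i)
    (hlt : ∀ j, j ≠ i → inner ℝ (intPt (v j)) p < h j) : p ∈ poly (fun i => intPt (v i)) h := by
  intro j
  by_cases hj : j = i
  · subst hj; exact hp.le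
  · exact (hlt j hj).le

theorem ne_zero_of_isSmooth (hs : IsSmooth v h) (hirr : IsIrredundant v h) (i : ι) : v i ≠ 0 := by
  obtain ⟨p, hp, hlt⟩ := hirr i
  obtain ⟨u, hu⟩ := hs p (mem_poly_of_facet_point hp hlt)
  have h1 := hu.1 i (by simpa [mem_active] using hp)
  intro h0
  rw [h0, dotProduct_zero] at h1
  exact zero_ne_one h1

theorem vectorSpan_le_orthogonal {F : Set (Pt n)} {w : Pt n} {c : ℝ}
    (hF : ∀ x ∈ F, inner ℝ w x = c) : vectorSpan ℝ F ≤ (ℝ ∙ w)ᗮ := by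
  rw [vectorSpan_def, Submodule.span_le]
  rintro _ ⟨x, hx, y, hy, rfl⟩
  rw [SetLike.mem_coe, Submodule.mem_orthogonal_singleton_iff_inner_right]
  simp only [vsub_eq_sub]
  rw [inner_sub_right, hF x hx, hF y hy, sub_self]

theorem finrank_orthogonal_singleton {w : Pt n} (hw : w ≠ 0) :
    Module.finrank ℝ (ℝ ∙ w)ᗮ + 1 = n := by
  have h1 := Submodule.finrank_add_finrank_orthogonal (ℝ ∙ w)
  rw [finrank_span_singleton hw, finrank_euclideanSpace, Fintype.card_fin] at h1
  omega

theorem faceDir_normal_eq {ι : Type*} {v : ι → Fin n → ℤ} {h : ι → ℝ} (hirr : IsIrredundant v h) (i : ι) :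
    faceDir (poly (fun i => intPt (v i)) h) (intPt (v i)) =
      {x | x ∈ poly (fun i => intPt (v i)) h ∧ inner ℝ (intPt (v i)) x = h i} := by
  obtain ⟨p, hp, hlt⟩ := hirr i
  ext x
  refine and_congr_right fun hx => ⟨fun hmax => (hx i).antisymm ?_, fun he z hz => ?_⟩
  · rw [← hp]
    exact hmax p (mem_poly_of_facet_point hp hlt)
  · rw [he]
    exact hz i

/-- At a point where only constraint i is active, small steps in every direction orthogonal to v i
stay in the face. -/
theorem vectorSpan_faceDir_normal (hirr : IsIrredundant v h) (i : ι) :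
    vectorSpan ℝ (faceDir (poly (fun i => intPt (v i)) h) (intPt (v i))) =
      (ℝ ∙ intPt (v i))ᗮ := by
  rw [faceDir_normal_eq hirr]
  refine le_antisymm (vectorSpan_le_orthogonal fun x hx => hx.2) fun d hd => ?_
  rw [Submodule.mem_orthogonal_singleton_iff_inner_right] at hd
  obtain ⟨p, hp, hlt⟩ := hirr i
  have hpm := mem_poly_of_facet_point hp hlt
  obtain ⟨ε, hε, h1⟩ := exists_pos_add_smul_mem_poly hpm (d := d) (by
    intro j hj
    by_cases hji : j = i
    · subst hji; exact hd.le
    · exact absurd (mem_active.1 hj) (hlt j hji).ne)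
  have h2 : (p + ε • d) -ᵥ p ∈ vectorSpan ℝ
      {x | x ∈ poly (fun i => intPt (v i)) h ∧ inner ℝ (intPt (v i)) x = h i} := by
    refine vsub_mem_vectorSpan ℝ ⟨h1, ?_⟩ ⟨hpm, hp⟩
    rw [inner_add_right, real_inner_smul_right, hd, hp, mul_zero, add_zero]
  rw [vsub_eq_sub, add_sub_cancel_left] at h2
  exact (Submodule.smul_mem_iff _ hε.ne').1 h2

theorem isFacet_faceDir_normal (hs : IsSmooth v h) (hirr : IsIrredundant v h) (i : ι) :
    IsFacet (poly (fun i => intPt (v i)) h)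
      (faceDir (poly (fun i => intPt (v i)) h) (intPt (v i))) := by
  refine ⟨⟨_, rfl⟩, ?_⟩
  rw [vectorSpan_faceDir_normal hirr]
  exact finrank_orthogonal_singleton (intPt_ne_zero (ne_zero_of_isSmooth hs hirr i))

theorem faceDir_normal_injective {ι : Type*} {v : ι → Fin n → ℤ} {h : ι → ℝ} (hirr : IsIrredundant v h) :
    Function.Injective fun i => faceDir (poly (fun i => intPt (v i)) h) (intPt (v i)) := by
  intro i j hij
  obtain ⟨p, hp, hlt⟩ := hirr i
  simp only [faceDir_normal_eq hirr] at hij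
  have h1 : p ∈ {x | x ∈ poly (fun i => intPt (v i)) h ∧ inner ℝ (intPt (v j)) x = h j} :=
    hij ▸ ⟨mem_poly_of_facet_point hp hlt, hp⟩
  by_contra hne
  exact (hlt j (Ne.symm hne)).ne h1.2

theorem faceDir_smul {P : Set (Pt n)} {a : ℝ} (ha : 0 < a) (w : Pt n) :
    faceDir P (a • w) = faceDir P w := by
  ext x
  simp only [faceDir, Set.mem_ofPred_eq, real_inner_smul_left, mul_le_mul_iff_right₀ ha]

/-- At a point of the facet with fewest active constraints, α is a nonnegative combination of the
active normals. The facet is orthogonal to all of them, so its dimension leaves room for only one.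
-/
theorem exists_eq_faceDir_normal_of_isFacet (hs : IsSmooth v h) (hirr : IsIrredundant v h)
    (hc : IsCompact (poly (fun i => intPt (v i)) h))
    (hi : (interior (poly (fun i => intPt (v i)) h)).Nonempty) {F : Set (Pt n)}
    (hF : IsFacet (poly (fun i => intPt (v i)) h) F) :
    ∃ i, faceDir (poly (fun i => intPt (v i)) h) (intPt (v i)) = F := by
  obtain ⟨⟨α, rfl⟩, hdim⟩ := hF
  obtain ⟨x, hx, hmin⟩ := exists_forall_active_subset (convex_faceDir convex_poly α)
    (faceDir_nonempty hc (hi.mono interior_subset) α) (fun _ hy => hy.1)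
  obtain ⟨u, hu⟩ := hs x hx.1
  obtain ⟨a, ha, hα⟩ := exists_nonneg_combination hu hx.1 hx.2
  -- The face in direction 0 is the whole polyhedron, of dimension n instead of n - 1.
  have hα0 : α ≠ 0 := by
    rintro rfl
    have h1 : faceDir (poly (fun i => intPt (v i)) h) 0 = poly (fun i => intPt (v i)) h := by
      ext y; simp [faceDir]
    rw [h1, ← direction_affineSpan, (isFullDimPolytope_poly hc hi).2, AffineSubspace.direction_top,
      finrank_top, finrank_euclideanSpace, Fintype.card_fin] at hdim
    omega
  obtain ⟨i, hiI, hai⟩ : ∃ i ∈ active (fun i => intPt (v i)) h x, a i • intPt (v i) ≠ 0 := by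
    by_contra! hcon
    exact hα0 (hα.trans (Finset.sum_eq_zero hcon))
  have hle : ∀ j ∈ active (fun i => intPt (v i)) h x,
      vectorSpan ℝ (faceDir (poly (fun i => intPt (v i)) h) α) ≤ (ℝ ∙ intPt (v j))ᗮ :=
    fun j hj => vectorSpan_le_orthogonal (c := h j) fun y hy =>
      (mem_active (w := fun i => intPt (v i))).1 (hmin y hy hj)
  have hspan : vectorSpan ℝ (faceDir (poly (fun i => intPt (v i)) h) α) =
      (ℝ ∙ intPt (v i))ᗮ := by
    refine Submodule.eq_of_le_of_finrank_eq (hle i hiI) ?_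
    have := finrank_orthogonal_singleton (intPt_ne_zero (ne_zero_of_isSmooth hs hirr i))
    omega
  -- If another j were active, u j would be orthogonal to v i, hence parallel to the facet, hence
  -- orthogonal to v j, against ⟨u j, v j⟩ = 1.
  have hact : ∀ j ∈ active (fun i => intPt (v i)) h x, j = i := by
    intro j hj
    by_contra hne
    have h1 : intPt (u j) ∈ (ℝ ∙ intPt (v i))ᗮ := by
      rw [Submodule.mem_orthogonal_singleton_iff_inner_left]
      exact hu.inner_of_ne hj hiI hne
    rw [← hspan] at h1
    have h2 := hle j hj h1
    rw [Submodule.mem_orthogonal_singleton_iff_inner_left, hu.inner_self hj] at h2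
    exact one_ne_zero h2
  rw [Finset.sum_eq_single i (fun j hj hne => absurd (hact j hj) hne)
    (fun h => absurd hiI h)] at hα
  have hpos : 0 < a i := lt_of_le_of_ne (ha i) fun h0 => hai (by rw [← h0, zero_smul])
  exact ⟨i, by rw [hα, faceDir_smul hpos]⟩

theorem hasFacets_poly (hs : IsSmooth v h) (hirr : IsIrredundant v h)
    (hc : IsCompact (poly (fun i => intPt (v i)) h))
    (hi : (interior (poly (fun i => intPt (v i)) h)).Nonempty) :
    HasFacets (poly (fun i => intPt (v i)) h) (Fintype.card ι) := by
  have h1 : {F | IsFacet (poly (fun i => intPt (v i)) h) F} =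
      Set.range fun i => faceDir (poly (fun i => intPt (v i)) h) (intPt (v i)) := by
    ext F
    exact ⟨exists_eq_faceDir_normal_of_isFacet hs hirr hc hi, by
      rintro ⟨i, rfl⟩
      exact isFacet_faceDir_normal hs hirr i⟩
  rw [HasFacets, h1, ← Set.image_univ, (faceDir_normal_injective hirr).encard_image,
    Set.encard_univ, ENat.card_eq_coe_fintype_card]

end Facets

/-! ### Facet presentation of Delzant polytopes -/

section Presentation

variable {n : ℕ} {P : Set (Pt n)}

/-- A small perturbation of a direction by a vector that is constant on its face keeps the face. -/
theorem exists_pos_add_smul_mem_normalCone {S : Finset (Pt n)}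
    (hP : P = convexHull ℝ (S : Set (Pt n))) {w d : Pt n} {c : ℝ}
    (hd : ∀ x ∈ faceDir P w, inner ℝ d x = c) :
    ∃ ε > (0 : ℝ), w + ε • d ∈ normalCone P (faceDir P w) := by
  rcases (faceDir P w).eq_empty_or_nonempty with he | ⟨p, hp⟩
  · exact ⟨1, one_pos, by rw [he]; exact Set.empty_subset _⟩
  have hSP : ∀ s ∈ S, s ∈ P := fun s hs => hP ▸ subset_convexHull ℝ _ hs
  -- Only the finitely many points of S need testing: those on the face stay level with p, the
  -- others are strictly lower and remain so for small ε.
  have h1 : ∀ᶠ ε in 𝓝[>] (0 : ℝ), ∀ s ∈ S, inner ℝ (w + ε • d) s ≤ inner ℝ (w + ε • d) p := by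
    refine (Finset.eventually_all S).2 fun s hs => ?_
    by_cases hsF : s ∈ faceDir P w
    · refine Eventually.of_forall fun ε => ?_
      rw [inner_add_left, inner_add_left, real_inner_smul_left, real_inner_smul_left, hd s hsF,
        hd p hp]
      linarith [hp.2 s (hSP s hs)]
    · have hlt : inner ℝ (w + (0 : ℝ) • d) s < inner ℝ (w + (0 : ℝ) • d) p := by
        rw [zero_smul, add_zero]
        refine lt_of_le_of_ne (hp.2 s (hSP s hs)) fun he => hsF ⟨hSP s hs, fun x hx => ?_⟩
        rw [he]
        exact hp.2 x hx
      have hc1 : Continuous fun ε : ℝ => inner ℝ (w + ε • d) s := by fun_prop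
      have hc2 : Continuous fun ε : ℝ => inner ℝ (w + ε • d) p := by fun_prop
      exact ((hc1.tendsto 0).eventually_lt (hc2.tendsto 0) hlt).filter_mono nhdsWithin_le_nhds |>.mono
        fun _ h => h.le
  obtain ⟨ε, h2, hε⟩ := (h1.and self_mem_nhdsWithin).exists
  refine ⟨ε, hε, fun q hq => ⟨hq.1, fun x hx => ?_⟩⟩
  have hpq : inner ℝ (w + ε • d) q = inner ℝ (w + ε • d) p := by
    rw [inner_add_left, inner_add_left, real_inner_smul_left, real_inner_smul_left, hd q hq,
      hd p hp, (hp.2 q hq.1).antisymm (hq.2 p hp.1)]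
  rw [hpq]
  have hsub : P ⊆ {x | inner ℝ (w + ε • d) x ≤ inner ℝ (w + ε • d) p} := by
    rw [hP]
    exact convexHull_min h2 (convex_halfSpace_le
      ⟨fun x y => inner_add_right _ _ _, fun c x => real_inner_smul_right _ _ _⟩ _)
  exact hsub hx

theorem generator_mem_coneGen {k : ℕ} (g : Fin k → Pt n) (i : Fin k) : g i ∈ coneGen g :=
  ⟨Pi.single i 1, fun l => by by_cases h : l = i <;> simp [h], by
    simp [Pi.single_apply]⟩

theorem inner_eq_of_mem_normalCone {F : Set (Pt n)} {β x y : Pt n} (hFP : F ⊆ P)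
    (hβ : β ∈ normalCone P F) (hx : x ∈ F) (hy : y ∈ F) : inner ℝ β x = inner ℝ β y :=
  ((hβ hy).2 x (hFP hx)).antisymm ((hβ hx).2 y (hFP hy))

/-- The face that belongs to a generator of a unimodular normal cone has a normal cone that is
spanned by this generator. -/
theorem normalCone_faceDir_generator {S : Finset (Pt n)}
    (hP : P = convexHull ℝ (S : Set (Pt n))) {F : Set (Pt n)} (hF : F.Nonempty)
    {k : ℕ} {g : Fin k → Pt n} (hli : LinearIndependent ℝ g) (hC : normalCone P F = coneGen g)
    (i : Fin k) {β : Pt n} (hβ : β ∈ normalCone P (faceDir P (g i))) :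
    ∃ b : ℝ, 0 ≤ b ∧ β = b • g i := by
  have hg : ∀ j, g j ∈ normalCone P F := fun j => by
    rw [hC]
    exact generator_mem_coneGen g j
  have hFi : F ⊆ faceDir P (g i) := hg i
  have hsub : normalCone P (faceDir P (g i)) ⊆ coneGen g := by
    rw [← hC]; exact fun γ hγ => hFi.trans hγ
  obtain ⟨b, hb, rfl⟩ := hsub hβ
  -- Since β is constant on the face of g i, the vector g i - ε β is still in the cone. For j ≠ i
  -- its coefficient -ε b j must be nonnegative, which forces b j = 0.
  obtain ⟨ε, hε, h1⟩ := exists_pos_add_smul_mem_normalCone hP (w := g i)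
    (d := -∑ j, b j • g j) (c := -inner ℝ (∑ j, b j • g j) hF.some) (by
      intro x hx
      rw [inner_neg_left, inner_eq_of_mem_normalCone (fun _ h => h.1) hβ hx (hFi hF.some_mem)])
  obtain ⟨a, ha, h2⟩ := hsub h1
  have h3 : ∑ j, (a j + ε * b j) • g j = ∑ j, (Pi.single i (1 : ℝ) : Fin k → ℝ) j • g j := by
    have h4 : ∑ j, (Pi.single i (1 : ℝ) : Fin k → ℝ) j • g j = g i := by
      simp [Pi.single_apply]
    rw [h4]
    simp only [add_smul, mul_smul, Finset.sum_add_distrib]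
    rw [← Finset.smul_sum, ← h2, smul_neg]
    abel
  have h5 : ∀ j, j ≠ i → b j = 0 := by
    intro j hj
    have h6 := Fintype.linearIndependent_iff.1 hli
      (fun j => (a j + ε * b j) - (Pi.single i (1 : ℝ) : Fin k → ℝ) j)
      (by simp only [sub_smul, Finset.sum_sub_distrib, h3, sub_self]) j
    simp only [Pi.single_eq_of_ne hj, sub_zero] at h6
    have h7 := ha j
    have h8 := mul_nonneg hε.le (hb j)
    have h9 : ε * b j = 0 := by linarith
    exact (mul_eq_zero.1 h9).resolve_left hε.ne'
  refine ⟨b i, hb i, Finset.sum_eq_single i (fun j _ hj => by rw [h5 j hj, zero_smul])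
    fun h => absurd (Finset.mem_univ i) h⟩

/-- A face with a one-dimensional normal cone is a facet. -/
theorem isFacet_of_normalCone {S : Finset (Pt n)} (hP : P = convexHull ℝ (S : Set (Pt n)))
    {w : Pt n} (hw : w ≠ 0) (hne : (faceDir P w).Nonempty)
    (hN : ∀ β ∈ normalCone P (faceDir P w), ∃ b : ℝ, β = b • w) :
    IsFacet P (faceDir P w) := by
  refine ⟨⟨w, rfl⟩, ?_⟩
  obtain ⟨p, hp⟩ := hne
  have h1 : vectorSpan ℝ (faceDir P w) = (ℝ ∙ w)ᗮ := by
    refine le_antisymm (vectorSpan_le_orthogonal (c := inner ℝ w p) fun x hx =>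
      (hp.2 x hx.1).antisymm (hx.2 p hp.1)) ?_
    -- A vector d orthogonal to the face is constant on it, so w + ε d is in the normal cone and
    -- hence a multiple of w.
    refine Submodule.orthogonal_le_iff_orthogonal_le.2 fun d hd => ?_
    obtain ⟨ε, hε, h2⟩ := exists_pos_add_smul_mem_normalCone hP (w := w) (d := d)
      (c := inner ℝ d p) (by
        intro x hx
        have h3 := (Submodule.mem_orthogonal _ _).1 hd _ (vsub_mem_vectorSpan ℝ hx hp)
        rw [vsub_eq_sub, real_inner_comm, inner_sub_right] at h3
        linarith)
    obtain ⟨b, hb⟩ := hN _ h2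
    rw [Submodule.mem_span_singleton]
    refine ⟨ε⁻¹ * (b - 1), ?_⟩
    have h4 : ε • d = (b - 1) • w := by rw [sub_smul, ← hb, one_smul]; abel
    rw [mul_smul, ← h4, smul_smul, inv_mul_cancel₀ hε.ne', one_smul]
  rw [h1]
  exact finrank_orthogonal_singleton hw

/-- A Delzant polytope with `m` facets is given by `m` inequalities with integer normals. -/
theorem exists_eq_poly (hn : 0 < n) {m : ℕ} (hD : IsDelzant P) (hm : HasFacets P m) :
    ∃ (v : Fin m → Fin n → ℤ) (h : Fin m → ℝ), (∀ i, v i ≠ 0) ∧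
      P = poly (fun i => intPt (v i)) h := by
  obtain ⟨⟨⟨S, hS⟩, hspan⟩, hfan⟩ := hD
  have hne : P.Nonempty := by
    refine (affineSpan_nonempty ℝ).1 ?_
    rw [hspan]
    exact ⟨0, trivial⟩
  have hc : IsCompact P := by
    rw [hS]
    exact S.finite_toSet.isCompact_convexHull ℝ
  have hfin : {F | IsFacet P F}.Finite := Set.finite_of_encard_eq_coe hm
  have hcard : Nat.card {F | IsFacet P F} = m := by
    rw [Nat.card_coe_set_eq, Set.ncard, hm]; rfl
  have e : {F | IsFacet P F} ≃ Fin m := by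
    haveI := hfin.to_subtype
    exact (Finite.equivFin _).trans (finCongr hcard)
  -- One normal is fixed per face, independently of the cone in which it appears as a generator w.
  -- Two integer generators of the same ray differ by a nonnegative factor. Sets that are not such
  -- faces get an arbitrary nonzero vector.
  have hv : ∀ F : Set (Pt n), ∃ v : Fin n → ℤ, v ≠ 0 ∧ ∀ w : Fin n → ℤ, w ≠ 0 → F = faceDir P (intPt w) →
      (∀ β ∈ normalCone P F, ∃ b : ℝ, 0 ≤ b ∧ β = b • intPt w) →
      ∃ b : ℝ, 0 ≤ b ∧ intPt w = b • intPt v ∧ F = faceDir P (intPt v) := by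
    intro F
    by_cases hF : ∃ w : Fin n → ℤ, w ≠ 0 ∧ F = faceDir P (intPt w) ∧
      ∀ β ∈ normalCone P F, ∃ b : ℝ, 0 ≤ b ∧ β = b • intPt w
    · obtain ⟨v, hv0, hvF, hvN⟩ := hF
      refine ⟨v, hv0, fun w _ hwF _ => ?_⟩
      obtain ⟨b, hb, hb'⟩ := hvN (intPt w) hwF.subset
      exact ⟨b, hb, hb', hvF⟩
    · refine ⟨Pi.single ⟨0, hn⟩ 1, by simp, fun w hw hwF hwN => absurd ⟨w, hw, hwF, hwN⟩ hF⟩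
  choose v hv0 hv using hv
  have hsup : ∀ w : Pt n, ∃ c : ℝ, ∀ p ∈ faceDir P w, inner ℝ w p = c := by
    intro w
    obtain ⟨p, hp⟩ := faceDir_nonempty hc hne w
    exact ⟨inner ℝ w p, fun q hq => (hp.2 q hq.1).antisymm (hq.2 p hp.1)⟩
  choose c hsup using hsup
  refine ⟨fun i => v (e.symm i), fun i => c (intPt (v (e.symm i))), fun i => hv0 _, ?_⟩
  apply Set.Subset.antisymm
  · intro x hx i
    obtain ⟨p, hp⟩ := faceDir_nonempty hc hne (intPt (v (e.symm i)))
    exact (hp.2 x hx).trans (hsup _ p hp).le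
  · intro x hx
    by_contra hxP
    -- A separating direction α lies in the normal cone of its own face. The generators of this cone
    -- are facet normals up to scaling, and x obeys the facet inequalities, so x cannot exceed the
    -- maximum of α on P.
    obtain ⟨f, r, hf1, hf2⟩ := geometric_hahn_banach_closed_point
      (hS ▸ convex_convexHull ℝ _ : Convex ℝ P) hc.isClosed hxP
    set α : Pt n := (InnerProductSpace.toDual ℝ (Pt n)).symm f with hα
    have hfα : ∀ y, f y = inner ℝ α y := fun y => by
      rw [hα, InnerProductSpace.toDual_symm_apply]
    obtain ⟨p, hp⟩ := faceDir_nonempty hc hne α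
    obtain ⟨k, g, -, hli, hC, -⟩ := hfan _ ⟨_, ⟨α, rfl⟩, rfl⟩
    have hαC : α ∈ normalCone P (faceDir P α) := Set.Subset.refl _
    rw [hC] at hαC
    obtain ⟨a, ha, hα'⟩ := hαC
    have hgi : ∀ i, inner ℝ (intPt (g i)) x ≤ inner ℝ (intPt (g i)) p := by
      intro i
      have hN := fun β (hβ : β ∈ normalCone P (faceDir P (intPt (g i)))) =>
        normalCone_faceDir_generator hS ⟨p, hp⟩ hli hC i hβ
      have hpi : p ∈ faceDir P (intPt (g i)) := by
        have : intPt (g i) ∈ normalCone P (faceDir P α) := by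
          rw [hC]
          exact generator_mem_coneGen _ i
        exact this hp
      have hfac := isFacet_of_normalCone hS (hli.ne_zero i) ⟨p, hpi⟩
        fun β hβ => (hN β hβ).imp fun _ h => h.2
      obtain ⟨b, hb, hb', hFv⟩ := hv _ (g i) (fun h0 => hli.ne_zero i (by
        rw [h0]; ext; simp [intPt])) rfl hN
      have h1 := hx (e ⟨_, hfac⟩)
      simp only [Equiv.symm_apply_apply] at h1
      rw [hb', real_inner_smul_left, real_inner_smul_left]
      refine mul_le_mul_of_nonneg_left ?_ hb
      rw [hsup _ p (hFv ▸ hpi)]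
      exact h1
    have h2 : inner ℝ α x ≤ inner ℝ α p := by
      rw [hα', sum_inner, sum_inner]
      refine Finset.sum_le_sum fun i _ => ?_
      rw [real_inner_smul_left, real_inner_smul_left]
      exact mul_le_mul_of_nonneg_left (hgi i) (ha i)
    have h3 := hf1 p hp.1
    rw [hfα] at h3 hf2
    linarith

end Presentation

/-! ### Upper bounds for the dimension -/

section Upper

variable {n m : ℕ}

theorem exists_nat_inradius_circumradius {P : Set (Pt n)} (hi : (interior P).Nonempty)
    (hb : Bornology.IsBounded P) : ∃ k : ℕ, (∃ c, closedBall c (1 / ((k : ℝ) + 1)) ⊆ P) ∧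
      P ⊆ closedBall 0 k := by
  obtain ⟨c, hc⟩ := hi
  obtain ⟨r, hr, hrP⟩ := nhds_basis_closedBall.mem_iff.1 (mem_interior_iff_mem_nhds.1 hc)
  obtain ⟨R, hR⟩ := hb.subset_closedBall 0
  obtain ⟨k₁, hk₁⟩ := exists_nat_one_div_lt hr
  obtain ⟨k₂, hk₂⟩ := exists_nat_ge R
  refine ⟨max k₁ k₂, ⟨c, (closedBall_subset_closedBall ?_).trans hrP⟩,
    hR.trans (closedBall_subset_closedBall (hk₂.trans (by exact_mod_cast le_max_right _ _)))⟩
  refine le_trans ?_ hk₁.le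
  gcongr
  exact le_max_left _ _

/-- The classes with fixed normals, inradius at least 1 / (k + 1) and circumradius at most k are
countably many. On each of them the right hand sides are coordinates in ℝᵐ by `hL`. The map `toSet`
leaves the metric open, so both distances are covered. -/
theorem dimH_le_of_poly {X : Type*} [EMetricSpace X] (toSet : X → Set (Pt n)) {s : Set X}
    (hs : ∀ K ∈ s, ∃ (v : Fin m → Fin n → ℤ) (h : Fin m → ℝ), (∀ i, v i ≠ 0) ∧
      toSet K = poly (fun i => intPt (v i)) h)
    (hi : ∀ K ∈ s, (interior (toSet K)).Nonempty)
    (hb : ∀ K ∈ s, Bornology.IsBounded (toSet K))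
    (hL : ∀ r > (0 : ℝ), ∀ R : ℝ, ∃ C : ℝ≥0, ∀ (w : Fin m → Pt n) (h h' : Fin m → ℝ) (K L : X)
      (c c' : Pt n), (∀ i, 1 ≤ ‖w i‖) → toSet K = poly w h → toSet L = poly w h' →
      closedBall c r ⊆ poly w h → closedBall c' r ⊆ poly w h' → poly w h ⊆ closedBall 0 R →
      poly w h' ⊆ closedBall 0 R → edist K L ≤ C * edist h h') :
    dimH s ≤ m := by
  set E : (Fin m → Fin n → ℤ) → ℕ → Set X := fun v k => {K | (∀ i, v i ≠ 0) ∧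
    (∃ h, toSet K = poly (fun i => intPt (v i)) h) ∧
    (∃ c, closedBall c (1 / ((k : ℝ) + 1)) ⊆ toSet K) ∧ toSet K ⊆ closedBall 0 k} with hE
  have hsub : s ⊆ ⋃ v, ⋃ k, E v k := by
    intro K hK
    obtain ⟨v, h, hv, hKv⟩ := hs K hK
    obtain ⟨k, hk1, hk2⟩ := exists_nat_inradius_circumradius (hi K hK) (hb K hK)
    exact Set.mem_iUnion₂.2 ⟨v, k, hv, ⟨h, hKv⟩, hk1, hk2⟩
  refine (dimH_mono hsub).trans ?_
  rw [dimH_iUnion]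
  refine iSup_le fun v => ?_
  rw [dimH_iUnion]
  refine iSup_le fun k => ?_
  obtain ⟨C, hC⟩ := hL (1 / ((k : ℝ) + 1)) (by positivity) k
  have hchoose : ∀ K : X, ∃ h : Fin m → ℝ, K ∈ E v k →
      toSet K = poly (fun i => intPt (v i)) h := by
    intro K
    by_cases hK : K ∈ E v k
    · obtain ⟨h, hh⟩ := hK.2.1
      exact ⟨h, fun _ => hh⟩
    · exact ⟨0, fun h => absurd h hK⟩
  choose f hf using hchoose
  have h1 : dimH (E v k) ≤ Fintype.card (Fin m) := by
    refine dimH_le_card_of_edist_le (K := C) (f := f) fun K hK L hL => ?_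
    obtain ⟨c, hc⟩ := hK.2.2.1
    obtain ⟨c', hc'⟩ := hL.2.2.1
    exact hC _ _ _ K L c c' (fun i => one_le_norm_intPt (hK.1 i)) (hf K hK) (hf L hL)
      (hf K hK ▸ hc) (hf L hL ▸ hc') (hf K hK ▸ hK.2.2.2) (hf L hL ▸ hL.2.2.2)
  rwa [Fintype.card_fin] at h1

theorem IsFullDimPolytope.interior_nonempty {P : Set (Pt n)} (hP : IsFullDimPolytope P) :
    (interior P).Nonempty := by
  obtain ⟨⟨S, rfl⟩, hspan⟩ := hP
  exact (convex_convexHull ℝ _).interior_nonempty_iff_affineSpan_eq_top.2 hspan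

theorem dimH_delzantFacetsV_le (hn : 0 < n) : dimH (delzantFacetsV n m) ≤ m := by
  refine dimH_le_of_poly ProperBody.toSet (fun K hK => exists_eq_poly hn hK.1 hK.2)
    (fun K _ => K.interior_nonempty) (fun K _ => K.body.isCompact.isBounded) fun r hr R =>
    ⟨volLip n r R, fun w h h' K L c c' hw hK hL hc hc' hR hR' => ?_⟩
  exact ProperBody.edist_le_of_eq_poly hr hw hK hL hc hc' hR hR'

theorem dimH_delzantFacetsH_le (hn : 0 < n) : dimH (delzantFacetsH n m) ≤ m := by
  refine dimH_le_of_poly (fun K : ConvexBody (Pt n) => (K : Set (Pt n)))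
    (fun K hK => exists_eq_poly hn hK.1 hK.2)
    (fun K hK => hK.1.1.interior_nonempty) (fun K _ => K.isCompact.isBounded) fun r hr R =>
    ⟨(2 * R / r).toNNReal, fun w h h' K L c c' hw hK hL hc hc' hR hR' => ?_⟩
  have hR0 : 0 ≤ R := by
    have := hR (hc (mem_closedBall_self hr.le))
    rw [mem_closedBall_zero_iff] at this
    exact (norm_nonneg _).trans this
  rw [edist_dist, edist_dist, ← ENNReal.ofReal.eq_1, ← ENNReal.ofReal_mul (by positivity)]
  exact ENNReal.ofReal_le_ofReal (convexBody_dist_le_of_eq_poly hr hw hK hL hc hc' hR hR')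

theorem lipschitzWith_mk : LipschitzWith 1 (BodyOrbits.mk : ProperBody n → BodyOrbits n) :=
  fun P Q => by simpa using BodyOrbits.edist_mk_le P Q

theorem dimH_delzantFacetsQuot_le : dimH (delzantFacetsQuot n m) ≤ dimH (delzantFacetsV n m) :=
  lipschitzWith_mk.dimH_image_le _

end Upper

/-! ### Lower bounds for the distances of polyhedra with close right hand sides -/

section Slab

variable {n : ℕ}

/-- A piece of a slab, around the line spanned by `u`. -/
def slab (w u : Pt n) (ρ a b : ℝ) : Set (Pt n) :=
  {z | a < inner ℝ w z ∧ inner ℝ w z ≤ b ∧ ‖z - (inner ℝ w z : ℝ) • u‖ < ρ}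

variable {w u : Pt n} {ρ a b d D : ℝ}

theorem norm_le_of_mem_slab {z : Pt n} (hz : z ∈ slab w u ρ a b) {T : ℝ} (ha : -T ≤ a)
    (hb : b ≤ T) : ‖z‖ < ρ + T * ‖u‖ := by
  have h1 : z = (z - (inner ℝ w z : ℝ) • u) + (inner ℝ w z : ℝ) • u := by abel
  have h2 : |inner ℝ w z| ≤ T := abs_le.2 ⟨ha.trans hz.1.le, hz.2.1.trans hb⟩
  calc ‖z‖ ≤ ‖z - (inner ℝ w z : ℝ) • u‖ + ‖(inner ℝ w z : ℝ) • u‖ := by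
        conv_lhs => rw [h1]
        exact norm_add_le _ _
    _ < ρ + T * ‖u‖ := by
        rw [norm_smul, Real.norm_eq_abs]
        exact add_lt_add_of_lt_of_le hz.2.2 (by gcongr)

theorem add_smul_mem_slab (hu : inner ℝ w u = 1) {z : Pt n} {t : ℝ} (h1 : a < inner ℝ w z + t)
    (h2 : inner ℝ w z + t ≤ b) (h3 : ‖z - (inner ℝ w z : ℝ) • u‖ < ρ) :
    z + t • u ∈ slab w u ρ a b := by
  have h4 : inner ℝ w (z + t • u) = inner ℝ w z + t := by
    rw [inner_add_right, real_inner_smul_right, hu, mul_one]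
  refine ⟨by rwa [h4], by rwa [h4], ?_⟩
  rw [h4, add_smul, add_sub_add_right_eq_sub]
  exact h3

/-- About D / d translates along u of the slab of thickness d cover the slab of thickness D, so the
volume of a thin slab is at least proportional to its thickness. -/
theorem volume_slab_le (hu : inner ℝ w u = 1) (hd : 0 < d) (hdD : d ≤ D) (a : ℝ) :
    volume (slab w u ρ 0 D) ≤ ENNReal.ofReal (2 * D / d) * volume (slab w u ρ a (a + d)) := by
  set N := ⌈D / d⌉₊ with hN
  have hsub : slab w u ρ 0 D ⊆ ⋃ k ∈ Finset.range N,
      (fun z => z + (a - k * d) • u) ⁻¹' slab w u ρ a (a + d) := by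
    intro z hz
    have hpos : 0 < inner ℝ w z / d := div_pos hz.1 hd
    have hc1 : 0 < ⌈inner ℝ w z / d⌉₊ := Nat.ceil_pos.2 hpos
    obtain ⟨k, hk⟩ : ∃ k, ⌈inner ℝ w z / d⌉₊ = k + 1 := ⟨_, (Nat.sub_add_cancel hc1).symm⟩
    have h1 : inner ℝ w z / d ≤ (k : ℝ) + 1 := by
      have := Nat.le_ceil (inner ℝ w z / d)
      rw [hk] at this
      exact_mod_cast this
    have h2 : (k : ℝ) < inner ℝ w z / d := Nat.lt_ceil.1 (by omega)
    rw [div_le_iff₀ hd] at h1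
    rw [lt_div_iff₀ hd] at h2
    refine Set.mem_iUnion₂.2 ⟨k, Finset.mem_range.2 ?_, add_smul_mem_slab hu ?_ ?_ hz.2.2⟩
    · have : ⌈inner ℝ w z / d⌉₊ ≤ N := Nat.ceil_mono (by gcongr; exact hz.2.1)
      omega
    · linarith
    · linarith
  calc _ ≤ _ := measure_mono hsub
    _ ≤ ∑ k ∈ Finset.range N, volume ((fun z => z + (a - k * d) • u) ⁻¹' slab w u ρ a (a + d)) :=
      measure_biUnion_finset_le _ _
    _ = N * volume (slab w u ρ a (a + d)) := by
      simp [measure_preimage_add_right]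
    _ ≤ _ := by
      refine mul_le_mul' ?_ le_rfl
      rw [← ENNReal.ofReal_natCast]
      refine ENNReal.ofReal_le_ofReal ?_
      -- The number of translates is below D / d + 1, which is at most 2 D / d.
      have h1 : (1 : ℝ) ≤ D / d := (one_le_div hd).2 hdD
      have h2 := Nat.ceil_lt_add_one (zero_le_one.trans h1)
      rw [mul_div_assoc]
      linarith

theorem volume_slab_pos (hu : inner ℝ w u = 1) (hD : 0 < D) (hρ : 0 < ρ) :
    0 < volume (slab w u ρ 0 D) := by
  have ho : IsOpen {z : Pt n | 0 < inner ℝ w z ∧ inner ℝ w z < D ∧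
      ‖z - (inner ℝ w z : ℝ) • u‖ < ρ} := by
    have h1 : Continuous fun z : Pt n => inner ℝ w z := by fun_prop
    have h2 : Continuous fun z : Pt n => ‖z - (inner ℝ w z : ℝ) • u‖ := by fun_prop
    exact (isOpen_lt continuous_const h1).inter
      ((isOpen_lt h1 continuous_const).inter (isOpen_lt h2 continuous_const))
  refine (ho.measure_pos volume ⟨(D / 2) • u, ?_⟩).trans_le
    (measure_mono fun z hz => ⟨hz.1, hz.2.1.le, hz.2.2⟩)
  have h1 : inner ℝ w ((D / 2) • u) = D / 2 := by rw [real_inner_smul_right, hu, mul_one]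
  refine ⟨?_, ?_, ?_⟩
  · rw [h1]; linarith
  · rw [h1]; linarith
  · rw [h1, sub_self, norm_zero]; exact hρ

end Slab

/-! ### Recovering the right hand sides from the body -/

section Lower

variable {n : ℕ} {ι : Type*} [Fintype ι] {w : ι → Pt n} {h₁ : ι → ℝ}

theorem exists_inner_eq_one {w : Pt n} (hw : w ≠ 0) : ∃ u : Pt n, inner ℝ w u = 1 := by
  refine ⟨(‖w‖ ^ 2)⁻¹ • w, ?_⟩
  rw [real_inner_smul_right, real_inner_self_eq_norm_sq]
  exact inv_mul_cancel₀ (pow_ne_zero _ (norm_ne_zero_iff.2 hw))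

/-- Constraints that are strict at `p` stay strict for nearby points and right hand sides. -/
theorem eventually_forall_inner_lt {s : Set ι} {p : Pt n}
    (hp : ∀ j ∈ s, inner ℝ (w j) p < h₁ j) :
    ∀ᶠ z : (ι → ℝ) × Pt n in 𝓝 (h₁, p), ∀ j ∈ s, inner ℝ (w j) z.2 < z.1 j := by
  refine eventually_all.2 fun j => ?_
  by_cases hj : j ∈ s
  · have h1 : Continuous fun z : (ι → ℝ) × Pt n => inner ℝ (w j) z.2 := by fun_prop
    have h2 : Continuous fun z : (ι → ℝ) × Pt n => z.1 j := by fun_prop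
    exact ((h1.tendsto (h₁, p)).eventually_lt (h2.tendsto (h₁, p)) (hp j hj)).mono fun _ h _ => h
  · exact Eventually.of_forall fun _ h => absurd h hj

/-- Near p only constraint i matters, so the part of the slab h' i < ⟨w i, x⟩ ≤ h i close to p
belongs to the first polyhedron and not to the second. Its volume is at least a multiple of h i - h'
i. -/
theorem exists_ofReal_sub_le_volume {i : ι} (hw : w i ≠ 0) {p : Pt n}
    (hp : inner ℝ (w i) p = h₁ i) (hlt : ∀ j, j ≠ i → inner ℝ (w j) p < h₁ j) :
    ∃ C : ℝ≥0, ∀ᶠ ε in 𝓝[>] (0 : ℝ), ∀ h ∈ ball h₁ ε, ∀ h' ∈ ball h₁ ε,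
      ENNReal.ofReal (h i - h' i) ≤ C * volume (poly w h \ poly w h') := by
  obtain ⟨u, hu⟩ := exists_inner_eq_one hw
  obtain ⟨ε₁, hε₁, hball⟩ := Metric.eventually_nhds_iff_ball.1
    (eventually_forall_inner_lt (s := {j | j ≠ i}) hlt)
  -- A slab of radius ε₁ / 2 with levels in [-ε, ε] then stays within ε₁ of its centre, where the
  -- other constraints are strict. Its thickness is at most 2 ε.
  set ε := ε₁ / (2 * (‖u‖ + 1)) with hε
  have hε0 : 0 < ε := by positivity
  have hεu : ε * ‖u‖ ≤ ε₁ / 2 := by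
    rw [hε, div_mul_eq_mul_div, div_le_div_iff₀ (by positivity) (by positivity)]
    nlinarith [norm_nonneg u]
  have hεε : ε ≤ ε₁ := div_le_self hε₁.le (by linarith [norm_nonneg u])
  set s := volume (slab (w i) u (ε₁ / 2) 0 (2 * ε)) with hs
  have hs0 : s ≠ 0 := (volume_slab_pos hu (by positivity) (by positivity)).ne'
  have hs1 : s ≠ ∞ := by
    refine ((measure_mono (t := ball (0 : Pt n) (ε₁ / 2 + 2 * ε * ‖u‖)) fun z hz => ?_).trans_lt
      measure_ball_lt_top).ne
    rw [mem_ball_zero_iff]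
    exact norm_le_of_mem_slab hz (by linarith) le_rfl
  refine ⟨(ENNReal.ofReal (4 * ε) / s).toNNReal, ?_⟩
  filter_upwards [Ioo_mem_nhdsGT hε0] with ε' hε' h hh h' hh'
  rw [ENNReal.coe_toNNReal (ENNReal.div_ne_top ENNReal.ofReal_ne_top hs0)]
  rcases le_or_gt (h i - h' i) 0 with hle | hpos
  · rw [ENNReal.ofReal_of_nonpos hle]; exact zero_le
  have hcoord : ∀ g ∈ ball h₁ ε', |g i - h₁ i| < ε := fun g hg => by
    rw [← Real.dist_eq]
    exact (dist_le_pi_dist g h₁ i).trans_lt ((mem_ball.1 hg).trans hε'.2)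
  have hi := abs_lt.1 (hcoord h hh)
  have hi' := abs_lt.1 (hcoord h' hh')
  have hsub : slab (w i) u (ε₁ / 2) (h' i - h₁ i) (h' i - h₁ i + (h i - h' i)) ⊆
      (fun z => z + p) ⁻¹' (poly w h \ poly w h') := by
    intro z hz
    have hz1 := hz.1
    have hz2 := hz.2.1
    have hnorm := norm_le_of_mem_slab hz (T := ε) (by linarith) (by linarith)
    have hzi : inner ℝ (w i) (z + p) = inner ℝ (w i) z + h₁ i := by rw [inner_add_right, hp]
    have hj := hball (h, z + p) (by
      rw [mem_ball, Prod.dist_eq, max_lt_iff]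
      refine ⟨(mem_ball.1 hh).trans (hε'.2.trans_le hεε), ?_⟩
      rw [dist_eq_norm, add_sub_cancel_right]
      linarith)
    refine ⟨fun j => ?_, fun hmem => ?_⟩
    · by_cases hji : j = i
      · subst hji; linarith
      · exact (hj j hji).le
    · have := hmem i
      linarith
  have h1 := volume_slab_le (ρ := ε₁ / 2) hu hpos (D := 2 * ε) (by linarith) (h' i - h₁ i)
  have h2 := measure_mono (μ := volume) hsub
  rw [measure_preimage_add_right] at h2
  have h3 : s ≤ ENNReal.ofReal (2 * (2 * ε) / (h i - h' i)) * volume (poly w h \ poly w h') :=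
    h1.trans (mul_le_mul' le_rfl h2)
  have h4 : ENNReal.ofReal (h i - h' i) * s ≤
      ENNReal.ofReal (4 * ε) * volume (poly w h \ poly w h') := by
    calc _ ≤ ENNReal.ofReal (h i - h' i) *
          (ENNReal.ofReal (2 * (2 * ε) / (h i - h' i)) * volume (poly w h \ poly w h')) :=
          mul_le_mul' le_rfl h3
      _ = _ := by
        rw [← mul_assoc, ← ENNReal.ofReal_mul hpos.le]
        congr 2
        field_simp
        norm_num
  rw [ENNReal.mul_comm_div, ← mul_div_assoc, ENNReal.le_div_iff_mul_le (Or.inl hs0) (Or.inl hs1)]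
  exact h4

/-- The symmetric difference distance controls the right hand sides of irredundant constraints. -/
theorem exists_edist_le_mul_edist {v : ι → Fin n → ℤ} (hv : ∀ i, v i ≠ 0)
    (hirr : IsIrredundant v h₁) : ∃ C : ℝ≥0, ∃ ε > (0 : ℝ), ∀ h ∈ ball h₁ ε, ∀ h' ∈ ball h₁ ε,
      ∀ P Q : ProperBody n, P.toSet = poly (fun i => intPt (v i)) h →
      Q.toSet = poly (fun i => intPt (v i)) h' → edist h h' ≤ C * edist P Q := by
  have h1 : ∀ i, ∃ C : ℝ≥0, ∀ᶠ ε in 𝓝[>] (0 : ℝ), ∀ h ∈ ball h₁ ε, ∀ h' ∈ ball h₁ ε,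
      ENNReal.ofReal (h i - h' i) ≤ C * volume (poly (fun i => intPt (v i)) h \
        poly (fun i => intPt (v i)) h') := by
    intro i
    obtain ⟨p, hp, hlt⟩ := hirr i
    exact exists_ofReal_sub_le_volume (w := fun i => intPt (v i)) (intPt_ne_zero (hv i)) hp hlt
  choose C hC using h1
  obtain ⟨ε, h2, hε⟩ := ((eventually_all.2 hC).and self_mem_nhdsWithin).exists
  refine ⟨∑ i, C i, ε, hε, fun h hh h' hh' P Q hP hQ => edist_pi_le_iff.2 fun i => ?_⟩
  have hCi : (C i : ℝ≥0∞) ≤ (∑ i, C i : ℝ≥0) := by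
    exact_mod_cast Finset.single_le_sum (f := C) (fun _ _ => zero_le) (Finset.mem_univ i)
  rw [ProperBody.edist_def, hP, hQ, edist_dist, Real.dist_eq]
  rcases le_total (h' i) (h i) with hle | hle
  · rw [abs_of_nonneg (by linarith)]
    exact (h2 i h hh h' hh').trans (mul_le_mul' hCi le_self_add)
  · rw [abs_of_nonpos (by linarith), neg_sub]
    exact (h2 i h' hh' h hh).trans (mul_le_mul' hCi le_add_self)

/-- A point on facet i of one body has a point of the other body nearby. By Cauchy–Schwarz the value
of v i there drops by at most ‖v i‖ times the distance. -/
theorem edist_le_mul_edist_convexBody {v : ι → Fin n → ℤ} {h h' : ι → ℝ}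
    (hirr : IsIrredundant v h) (hirr' : IsIrredundant v h') {K L : ConvexBody (Pt n)}
    (hK : (K : Set (Pt n)) = poly (fun i => intPt (v i)) h)
    (hL : (L : Set (Pt n)) = poly (fun i => intPt (v i)) h') :
    edist h h' ≤ (∑ i, ‖intPt (v i)‖₊ : ℝ≥0) * edist K L := by
  have key : ∀ {h h' : ι → ℝ} {K L : ConvexBody (Pt n)}, IsIrredundant v h →
      (K : Set (Pt n)) = poly (fun i => intPt (v i)) h →
      (L : Set (Pt n)) = poly (fun i => intPt (v i)) h' →
      ∀ i, h i - h' i ≤ ‖intPt (v i)‖ * dist K L := by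
    intro h h' K L hirr hK hL i
    obtain ⟨p, hp, hlt⟩ := hirr i
    have hpK : p ∈ (K : Set (Pt n)) := hK ▸ mem_poly_of_facet_point hp hlt
    have h1 : ∀ r, dist K L < r → h i - h' i ≤ ‖intPt (v i)‖ * r := by
      intro r hr
      rw [← ConvexBody.hausdorffDist_coe] at hr
      obtain ⟨y, hy, hpy⟩ := exists_dist_lt_of_hausdorffDist_lt hpK hr
        ConvexBody.hausdorffEDist_ne_top
      rw [hL] at hy
      have h2 := hy i
      have h3 := real_inner_le_norm (intPt (v i)) (p - y)
      rw [inner_sub_right, hp, ← dist_eq_norm] at h3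
      have h4 : ‖intPt (v i)‖ * dist p y ≤ ‖intPt (v i)‖ * r := by gcongr
      linarith
    have hcont : Tendsto (fun r : ℝ => ‖intPt (v i)‖ * r) (𝓝[>] (dist K L))
        (𝓝 (‖intPt (v i)‖ * dist K L)) :=
      ((continuous_const.mul continuous_id).tendsto _).mono_left nhdsWithin_le_nhds
    exact ge_of_tendsto hcont (eventually_nhdsWithin_of_forall h1)
  refine edist_pi_le_iff.2 fun i => ?_
  have hCi : (‖intPt (v i)‖₊ : ℝ≥0∞) ≤ (∑ i, ‖intPt (v i)‖₊ : ℝ≥0) := by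
    exact_mod_cast Finset.single_le_sum (f := fun i => ‖intPt (v i)‖₊) (fun _ _ => zero_le)
      (Finset.mem_univ i)
  refine le_trans ?_ (mul_le_mul' hCi le_rfl)
  rw [edist_dist, edist_dist, ← enorm_eq_nnnorm, ← ofReal_norm,
    ← ENNReal.ofReal_mul (norm_nonneg _), Real.dist_eq]
  refine ENNReal.ofReal_le_ofReal (abs_sub_le_iff.2 ⟨key hirr hK hL i, ?_⟩)
  rw [dist_comm]
  exact key hirr' hL hK i

end Lower

/-! ### Stability under perturbations of the right hand sides -/

section Stability

variable {n : ℕ} {ι : Type*} [Fintype ι] {v : ι → Fin n → ℤ} {h₀ : ι → ℝ}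

/-- The witness p is moved along u to the new level of constraint i; the strict inequalities survive
a small move. -/
theorem eventually_isIrredundant (hv : ∀ i, v i ≠ 0) (hirr : IsIrredundant v h₀) :
    ∀ᶠ h in 𝓝 h₀, IsIrredundant v h := by
  refine eventually_all.2 fun i => ?_
  obtain ⟨p, hp, hlt⟩ := hirr i
  obtain ⟨u, hu⟩ := exists_inner_eq_one (intPt_ne_zero (hv i))
  have hc : Continuous fun h : ι → ℝ => (h, p + (h i - h₀ i) • u) := by fun_prop
  have h1 := hc.tendsto h₀
  simp only [sub_self, zero_smul, add_zero] at h1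
  filter_upwards [h1.eventually (eventually_forall_inner_lt (w := fun i => intPt (v i))
    (s := {j | j ≠ i}) hlt)] with h hh
  refine ⟨_, ?_, hh⟩
  rw [inner_add_right, real_inner_smul_right, hu, hp]
  ring

theorem eventually_poly_subset (w : ι → Pt n)
    (hb : ∀ h : ι → ℝ, Bornology.IsBounded (poly w h)) (h₀ : ι → ℝ) :
    ∃ R, ∀ᶠ h in 𝓝 h₀, poly w h ⊆ closedBall 0 R := by
  obtain ⟨R, hR⟩ := (hb (h₀ + 1)).subset_closedBall 0
  refine ⟨R, ?_⟩
  filter_upwards [ball_mem_nhds h₀ one_pos] with h hh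
  refine (poly_mono fun i => ?_).trans hR
  have h1 := (dist_le_pi_dist h h₀ i).trans_lt (mem_ball.1 hh)
  rw [Real.dist_eq] at h1
  simp only [Pi.add_apply, Pi.one_apply]
  linarith [le_abs_self (h i - h₀ i)]

/-- Near any (h₀, x) with x in the polyhedron, active sets can only shrink, so the dual system at x
still serves; points outside stay outside. Compactness of a ball containing all nearby polyhedra
makes this uniform in x. -/
theorem eventually_isSmooth (hb : ∀ h : ι → ℝ, Bornology.IsBounded (poly (fun i => intPt (v i)) h))
    (hs : IsSmooth v h₀) : ∀ᶠ h in 𝓝 h₀, IsSmooth v h := by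
  obtain ⟨R, hR⟩ := eventually_poly_subset _ hb h₀
  have h1 : ∀ᶠ h in 𝓝 h₀, ∀ x ∈ closedBall (0 : Pt n) R, x ∈ poly (fun i => intPt (v i)) h →
      ∃ u, IsDualOn v u (active (fun i => intPt (v i)) h x) := by
    refine (isCompact_closedBall _ _).eventually_forall_of_forall_eventually fun x _ => ?_
    by_cases hx : x ∈ poly (fun i => intPt (v i)) h₀
    · obtain ⟨u, hu⟩ := hs x hx
      filter_upwards [eventually_forall_inner_lt (w := fun i => intPt (v i)) (h₁ := h₀) (p := x)
        (s := {j | j ∉ active (fun i => intPt (v i)) h₀ x}) fun j hj =>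
          lt_of_le_of_ne (hx j) fun he => hj (mem_active.2 he)] with z hz _
      refine ⟨u, hu.mono fun j hj => ?_⟩
      by_contra hj'
      exact (hz j hj').ne (mem_active.1 hj)
    · obtain ⟨i, hi⟩ : ∃ i, h₀ i < inner ℝ (intPt (v i)) x := by
        by_contra! hcon
        exact hx hcon
      have hc1 : Continuous fun z : (ι → ℝ) × Pt n => inner ℝ (intPt (v i)) z.2 := by fun_prop
      have hc2 : Continuous fun z : (ι → ℝ) × Pt n => z.1 i := by fun_prop
      filter_upwards [(hc2.tendsto (h₀, x)).eventually_lt (hc1.tendsto (h₀, x)) hi] with z hz hzp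
      exact absurd (hzp i) (not_le.2 hz)
  filter_upwards [h1, hR] with h hh1 hh2 x hx
  exact hh1 x (hh2 hx) hx

/-- A small step inward from a facet point makes every constraint strict, with room for a ball and
for changes of h. -/
theorem exists_eventually_closedBall_subset [Nonempty ι] (hv : ∀ i, v i ≠ 0)
    (hirr : IsIrredundant v h₀) :
    ∃ c, ∃ r > (0 : ℝ), ∀ᶠ h in 𝓝 h₀, closedBall c r ⊆ poly (fun i => intPt (v i)) h := by
  obtain ⟨i⟩ := ‹Nonempty ι›
  obtain ⟨p, hp, hlt⟩ := hirr i
  have hpos : 0 < ‖intPt (v i)‖ := norm_pos_iff.2 (intPt_ne_zero (hv i))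
  have hq : ∃ q : Pt n, ∀ j, inner ℝ (intPt (v j)) q < h₀ j := by
    have hc : Continuous fun t : ℝ => (h₀, p + t • -intPt (v i)) := by fun_prop
    have h1 := hc.tendsto 0
    rw [zero_smul, add_zero] at h1
    obtain ⟨t, h2, ht⟩ := (((h1.eventually (eventually_forall_inner_lt
      (w := fun i => intPt (v i)) (s := {j | j ≠ i}) hlt)).filter_mono
      nhdsWithin_le_nhds).and (self_mem_nhdsWithin (s := Set.Ioi (0 : ℝ)))).exists
    refine ⟨p + t • -intPt (v i), fun j => ?_⟩
    by_cases hj : j = i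
    · subst hj
      rw [inner_add_right, real_inner_smul_right, inner_neg_right, real_inner_self_eq_norm_sq, hp]
      have : 0 < t * ‖intPt (v j)‖ ^ 2 := mul_pos ht (by positivity)
      linarith
    · exact h2 j hj
  obtain ⟨q, hq⟩ := hq
  obtain ⟨ε, hε, hball⟩ := Metric.eventually_nhds_iff_ball.1
    (eventually_forall_inner_lt (w := fun i => intPt (v i)) (h₁ := h₀) (s := Set.univ)
      (p := q) fun j _ => hq j)
  refine ⟨q, ε / 2, by positivity, ?_⟩
  filter_upwards [ball_mem_nhds h₀ hε] with h hh x hx j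
  refine (hball (h, x) ?_ j trivial).le
  rw [mem_ball, Prod.dist_eq, max_lt_iff]
  exact ⟨hh, (mem_closedBall.1 hx).trans_lt (by linarith)⟩

end Stability

/-! ### The quotient by `AGL(n, ℤ)` -/

section Quotient

variable {n : ℕ}

/-- If g • P is close to P, it contains a fixed ball, so g⁻¹ maps this ball into the bounded set P.
Only finitely many integral affine maps do so. -/
theorem exists_edist_smul_lt_finite (P : ProperBody n) :
    ∃ η > (0 : ℝ≥0∞), {g : AGLZ n | edist P (g • P) < η}.Finite := by
  obtain ⟨c, hc⟩ := P.interior_nonempty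
  obtain ⟨r, hr, hrP⟩ := nhds_basis_closedBall.mem_iff.1 (mem_interior_iff_mem_nhds.1 hc)
  obtain ⟨R, hR⟩ := P.body.isCompact.isBounded.subset_closedBall 0
  refine ⟨volume (ball (0 : Pt n) (r / 4)), measure_ball_pos _ _ (by positivity), ?_⟩
  refine ((AGLZ.finite_mapsTo c (half_pos hr) R).preimage (inv_injective.injOn)).subset ?_
  intro g hg
  have h1 := AGLZ.ball_subset_of_edist_lt hr hrP hg
  rintro _ ⟨x, hx, rfl⟩
  obtain ⟨q, hq, rfl⟩ := h1 hx
  have h2 : ((g⁻¹ : AGLZ n) : Pt n ≃ᵃ[ℝ] Pt n) ((g : Pt n ≃ᵃ[ℝ] Pt n) q) = q :=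
    (g : Pt n ≃ᵃ[ℝ] Pt n).symm_apply_apply q
  rw [h2]
  exact hR hq

/-- The orbit of `P` is discrete. -/
theorem exists_smul_eq_of_edist_lt (P : ProperBody n) :
    ∃ η > (0 : ℝ≥0∞), ∀ g : AGLZ n, edist P (g • P) < η → g • P = P := by
  obtain ⟨η, hη, hfin⟩ := exists_edist_smul_lt_finite P
  have h1 : ∀ᶠ ε in 𝓝[>] (0 : ℝ≥0∞), ∀ g ∈ {g : AGLZ n | edist P (g • P) < η},
      edist P (g • P) < ε → g • P = P := by
    refine (hfin.eventually_all).2 fun g _ => ?_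
    by_cases hg : g • P = P
    · exact Eventually.of_forall fun _ _ => hg
    · have hpos : 0 < edist P (g • P) := edist_pos.2 (Ne.symm hg)
      filter_upwards [Ioo_mem_nhdsGT hpos] with ε hε hlt
      exact absurd hlt (not_lt.2 hε.2.le)
  obtain ⟨ε, h2, hε⟩ := (h1.and (Ioo_mem_nhdsGT hη)).exists
  exact ⟨ε, hε.1, fun g hg => h2 g (hg.trans hε.2) hg⟩

theorem finite_stabilizer (P : ProperBody n) : {g : AGLZ n | g • P = P}.Finite := by
  obtain ⟨η, hη, hfin⟩ := exists_edist_smul_lt_finite P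
  refine hfin.subset fun g hg => ?_
  rw [Set.mem_ofPred_eq] at hg ⊢
  rw [hg, edist_self]
  exact hη

/-- A continuous family of bodies is, over some nonempty open set of parameters, locally isometric
to its image in the space of orbits. -/
theorem exists_edist_mk_eq {X : Type*} [TopologicalSpace X] {W : Set X} (hW : IsOpen W)
    (hne : W.Nonempty) {f : X → ProperBody n} (hf : ContinuousOn f W) :
    ∃ x₁ ∈ W, ∃ η > (0 : ℝ≥0∞), ∀ᶠ U in (𝓝 x₁).smallSets, ∀ x ∈ U, ∀ y ∈ U,
      edist (BodyOrbits.mk (f x)) (BodyOrbits.mk (f y)) < η →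
      edist (BodyOrbits.mk (f x)) (BodyOrbits.mk (f y)) = edist (f x) (f y) := by
  -- Stabilizers can only shrink near a point. Where the order is minimal they must be locally
  -- constant.
  obtain ⟨x₁, hx₁, hmin⟩ := exists_minimalFor_of_wellFoundedLT (· ∈ W)
    (fun x => {g : AGLZ n | g • f x = f x}.ncard) hne
  obtain ⟨η, hη, hη'⟩ := exists_smul_eq_of_edist_lt (f x₁)
  have hη3 : 0 < η / 3 := ENNReal.div_pos hη.ne' (by simp)
  refine ⟨x₁, hx₁, η / 3, hη3, ?_⟩
  have hU : {x | x ∈ W ∧ edist (f x₁) (f x) < η / 3} ∈ 𝓝 x₁ := by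
    have h1 := (hf.continuousAt (hW.mem_nhds hx₁)).eventually
      (Metric.eball_mem_nhds (f x₁) hη3)
    filter_upwards [hW.mem_nhds hx₁, h1] with x hx hx'
    exact ⟨hx, by rw [edist_comm]; exact hx'⟩
  refine eventually_smallSets.2 ⟨_, hU, fun U hUs x hx y hy hlt => ?_⟩
  -- Three errors of size η / 3 show that g moves f x₁ by less than η, hence not at all.
  have key : ∀ x ∈ U, ∀ y ∈ U, ∀ g : AGLZ n, edist (f x) (g • f y) < η / 3 → g • f x₁ = f x₁ := by
    intro x hx y hy g hg
    refine hη' g ?_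
    calc edist (f x₁) (g • f x₁)
        ≤ edist (f x₁) (f x) + edist (f x) (g • f y) + edist (g • f y) (g • f x₁) :=
          edist_triangle4 _ _ _ _
      _ < η / 3 + η / 3 + η / 3 := by
          refine ENNReal.add_lt_add (ENNReal.add_lt_add (hUs hx).2 hg) ?_
          rw [AGLZ.edist_smul, edist_comm]
          exact (hUs hy).2
      _ = η := ENNReal.add_thirds η
  have hstab : ∀ g : AGLZ n, g • f x₁ = f x₁ → g • f y = f y := by
    have hsub : {g : AGLZ n | g • f y = f y} ⊆ {g : AGLZ n | g • f x₁ = f x₁} := by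
      intro g hg
      rw [Set.mem_ofPred_eq] at hg
      refine key y hy y hy g ?_
      rw [hg, edist_self]
      exact hη3
    have heq := Set.eq_of_subset_of_ncard_le hsub (by
      by_contra hcon
      exact hcon (hmin (hUs hy).1 (not_le.1 hcon).le)) (finite_stabilizer _)
    intro g hg
    exact heq.symm.subset hg
  -- Any g that nearly realizes the orbit distance fixes f x₁, hence fixes f y, so it realizes only
  -- the distance from f x to f y itself.
  refine le_antisymm (BodyOrbits.edist_mk_le _ _) (le_of_forall_gt fun ε hε => ?_)
  obtain ⟨Q, hQ, hQε⟩ := BodyOrbits.exists_edist_lt (lt_min hε hlt)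
  obtain ⟨g, rfl⟩ := BodyOrbits.mk_eq_mk.1 hQ
  rw [hstab g (key x hx y hy g (hQε.trans_le (min_le_right _ _)))] at hQε
  exact hQε.trans_le (min_le_left _ _)

end Quotient

/-! ### From one smooth irredundant polyhedron to the lower bounds -/

section LowerDim

variable {n : ℕ} {ι : Type*} [Fintype ι] [Nonempty ι] {v : ι → Fin n → ℤ} {h₀ : ι → ℝ}

theorem exists_convexBody_eq_poly {ι : Type*} {v : ι → Fin n → ℤ} {h : ι → ℝ} {c : Pt n} {r : ℝ} (hr : 0 < r)
    (hb : Bornology.IsBounded (poly (fun i => intPt (v i)) h))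
    (hc : closedBall c r ⊆ poly (fun i => intPt (v i)) h) :
    ∃ K : ConvexBody (Pt n), (K : Set (Pt n)) = poly (fun i => intPt (v i)) h :=
  ⟨⟨_, convex_poly, isCompact_of_isClosed_isBounded isClosed_poly hb,
    ⟨c, hc (mem_closedBall_self hr.le)⟩⟩, rfl⟩

theorem interior_nonempty_of_closedBall {P : Set (Pt n)} {c : Pt n} {r : ℝ} (hr : 0 < r)
    (hc : closedBall c r ⊆ P) : (interior P).Nonempty :=
  ⟨c, mem_interior_iff_mem_nhds.2 (mem_of_superset (closedBall_mem_nhds c hr) hc)⟩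

theorem exists_ball_parameters (hv : ∀ i, v i ≠ 0)
    (hb : ∀ h : ι → ℝ, Bornology.IsBounded (poly (fun i => intPt (v i)) h))
    (hs : IsSmooth v h₀) (hirr : IsIrredundant v h₀) :
    ∃ (c : Pt n) (r : ℝ) (R : ℝ) (ε : ℝ), 0 < r ∧ 0 < ε ∧ ∀ h ∈ ball h₀ ε,
      IsSmooth v h ∧ IsIrredundant v h ∧ closedBall c r ⊆ poly (fun i => intPt (v i)) h ∧
      poly (fun i => intPt (v i)) h ⊆ closedBall 0 R := by
  obtain ⟨c, r, hr, hc⟩ := exists_eventually_closedBall_subset hv hirr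
  obtain ⟨R, hR⟩ := eventually_poly_subset _ hb h₀
  obtain ⟨ε, hε, h1⟩ := Metric.eventually_nhds_iff_ball.1 ((eventually_isSmooth hb hs).and
    ((eventually_isIrredundant hv hirr).and (hc.and hR)))
  exact ⟨c, r, R, ε, hr, hε, h1⟩

theorem dimH_of_isOpen_pi {ι : Type*} [Fintype ι] {U : Set (ι → ℝ)} (hU : IsOpen U) (hne : U.Nonempty) :
    dimH U = Fintype.card ι := by
  rw [Real.dimH_of_nonempty_interior (by rwa [hU.interior_eq]), Module.finrank_fintype_fun_eq_card]

theorem le_dimH_delzantFacetsH (hv : ∀ i, v i ≠ 0)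
    (hb : ∀ h : ι → ℝ, Bornology.IsBounded (poly (fun i => intPt (v i)) h))
    (hs : IsSmooth v h₀) (hirr : IsIrredundant v h₀) :
    (Fintype.card ι : ℝ≥0∞) ≤ dimH (delzantFacetsH n (Fintype.card ι)) := by
  obtain ⟨c, r, R, ε, hr, hε, hW⟩ := exists_ball_parameters hv hb hs hirr
  have hK : ∀ h, ∃ K : ConvexBody (Pt n), h ∈ ball h₀ ε →
      (K : Set (Pt n)) = poly (fun i => intPt (v i)) h := by
    intro h
    by_cases hh : h ∈ ball h₀ ε
    · exact (exists_convexBody_eq_poly hr (hb h) (hW h hh).2.2.1).imp fun _ h _ => h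
    · exact ⟨0, fun h => absurd h hh⟩
  choose f hf using hK
  rw [← dimH_of_isOpen_pi (isOpen_ball (x := h₀) (ε := ε)) ⟨h₀, mem_ball_self hε⟩]
  refine (dimH_le_dimH_image_of_edist_le (f := f) fun h hh h' hh' =>
    edist_le_mul_edist_convexBody (hW h hh).2.1 (hW h' hh').2.1 (hf h hh) (hf h' hh')).trans
    (dimH_mono ?_)
  rintro _ ⟨h, hh, rfl⟩
  obtain ⟨h1, h2, h3, h4⟩ := hW h hh
  have hc := isCompact_of_isClosed_isBounded isClosed_poly (hb h)
  have hi := interior_nonempty_of_closedBall hr h3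
  refine ⟨?_, ?_⟩ <;> rw [hf h hh]
  exacts [isDelzant_poly h1 hc hi, hasFacets_poly h1 h2 hc hi]

/-- On a small neighbourhood V the parameters inject into the orbits with a Lipschitz inverse: δ^V
controls the parameters, and orbit distances below η agree with δ^V. -/
theorem le_dimH_delzantFacetsQuot (hv : ∀ i, v i ≠ 0)
    (hb : ∀ h : ι → ℝ, Bornology.IsBounded (poly (fun i => intPt (v i)) h))
    (hs : IsSmooth v h₀) (hirr : IsIrredundant v h₀) :
    (Fintype.card ι : ℝ≥0∞) ≤ dimH (delzantFacetsQuot n (Fintype.card ι)) := by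
  obtain ⟨c, r, R, ε, hr, hε, hW⟩ := exists_ball_parameters hv hb hs hirr
  have hex : ∀ h ∈ ball h₀ ε, ∃ K : ProperBody n, K.toSet = poly (fun i => intPt (v i)) h := by
    intro h hh
    obtain ⟨K, hK⟩ := exists_convexBody_eq_poly hr (hb h) (hW h hh).2.2.1
    exact ⟨⟨K, hK ▸ interior_nonempty_of_closedBall hr (hW h hh).2.2.1⟩, hK⟩
  have hK : ∀ h, ∃ K : ProperBody n, h ∈ ball h₀ ε →
      K.toSet = poly (fun i => intPt (v i)) h := by
    intro h
    by_cases hh : h ∈ ball h₀ ε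
    · exact (hex h hh).imp fun _ h _ => h
    · exact ⟨(hex h₀ (mem_ball_self hε)).choose, fun h => absurd h hh⟩
  choose f hf using hK
  have hlip : LipschitzOnWith (volLip n r R) f (ball h₀ ε) := fun h hh h' hh' =>
    ProperBody.edist_le_of_eq_poly hr (fun i => one_le_norm_intPt (hv i)) (hf h hh) (hf h' hh')
      (hW h hh).2.2.1 (hW h' hh').2.2.1 (hW h hh).2.2.2 (hW h' hh').2.2.2
  obtain ⟨h₁, hh₁, η, hη, hU⟩ := exists_edist_mk_eq isOpen_ball ⟨h₀, mem_ball_self hε⟩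
    hlip.continuousOn
  obtain ⟨C, ε', hε', hC⟩ := exists_edist_le_mul_edist hv (hW h₁ hh₁).2.1
  obtain ⟨U₀, hU₀, hU⟩ := eventually_smallSets.1 hU
  obtain ⟨V, hVsub, hVo, hVh⟩ := _root_.mem_nhds_iff.1 (inter_mem (inter_mem hU₀
    (isOpen_ball.mem_nhds hh₁)) (inter_mem (ball_mem_nhds h₁ hε') (ball_mem_nhds h₁ one_pos)))
  rw [← dimH_of_isOpen_pi hVo ⟨h₁, hVh⟩]
  obtain ⟨δ, hδ, hδη⟩ : ∃ δ : ℝ≥0, 0 < δ ∧ (δ : ℝ≥0∞) < η := by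
    obtain ⟨δ, h1, h2⟩ := ENNReal.lt_iff_exists_nnreal_btwn.1 hη
    exact ⟨δ, by exact_mod_cast h1, h2⟩
  -- The term 2 / δ handles orbit distances at least η > δ: parameters in V are at distance at most
  -- 2, since V lies in a unit ball.
  refine (dimH_le_dimH_image_of_edist_le (f := fun h => BodyOrbits.mk (f h)) (K := C + 2 / δ)
    fun h hh h' hh' => ?_).trans (dimH_mono ?_)
  · have hm := hVsub hh
    have hm' := hVsub hh'
    rcases lt_or_ge (edist (BodyOrbits.mk (f h)) (BodyOrbits.mk (f h'))) η with hlt | hge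
    · rw [hU U₀ subset_rfl h hm.1.1 h' hm'.1.1 hlt]
      refine (hC h hm.2.1 h' hm'.2.1 _ _ (hf h hm.1.2) (hf h' hm'.1.2)).trans ?_
      push_cast
      exact mul_le_mul' le_self_add le_rfl
    · calc edist h h' ≤ edist h h₁ + edist h' h₁ := edist_triangle_right _ _ _
        _ ≤ 1 + 1 := by
          refine add_le_add ?_ ?_
          · rw [edist_dist, ← ENNReal.ofReal_one]
            exact ENNReal.ofReal_le_ofReal (mem_ball.1 hm.2.2).le
          · rw [edist_dist, ← ENNReal.ofReal_one]
            exact ENNReal.ofReal_le_ofReal (mem_ball.1 hm'.2.2).le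
        _ = ((2 / δ * δ : ℝ≥0) : ℝ≥0∞) := by
          rw [div_mul_cancel₀ _ hδ.ne']; norm_num
        _ ≤ _ := by
          rw [ENNReal.coe_mul]
          refine mul_le_mul' ?_ (hδη.le.trans hge)
          exact_mod_cast le_add_self
  · rintro _ ⟨h, hh, rfl⟩
    have hh := (hVsub hh).1.2
    obtain ⟨h1, h2, h3, h4⟩ := hW h hh
    have hc := isCompact_of_isClosed_isBounded isClosed_poly (hb h)
    have hi := interior_nonempty_of_closedBall hr h3
    refine ⟨f h, ⟨?_, ?_⟩, rfl⟩ <;> rw [hf h hh]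
    exacts [isDelzant_poly h1 hc hi, hasFacets_poly h1 h2 hc hi]

end LowerDim

/-! ### A Delzant polytope with a given number of facets

The simplex `x ≥ 0`, `x₀ + s ≤ c 0` with `s = x₁ + x₂ + ⋯`, cut successively by the half-spaces
`x₀ + (1 - i) s ≤ c i` for `i = 1, …, J`. -/

section Family

variable {k J : ℕ}

/-- The normals of the truncated simplex. -/
def truncNormal (k J : ℕ) : Fin (k + 2) ⊕ Fin (J + 1) → Fin (k + 2) → ℤ
  | Sum.inl j => -Pi.single j 1
  | Sum.inr i => fun j => if j = 0 then 1 else 1 - (i : ℤ)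

/-- The right hand sides of the upper constraints of the truncated simplex. -/
noncomputable def truncBound (J i : ℕ) : ℝ := 1 + ((J : ℝ) - i) * ((J : ℝ) - i + 1) / 2

/-- The right hand sides of the truncated simplex. -/
noncomputable def truncHeight (k J : ℕ) : Fin (k + 2) ⊕ Fin (J + 1) → ℝ
  | Sum.inl _ => 0
  | Sum.inr i => truncBound J i

theorem inner_truncNormal_inl (j : Fin (k + 2)) (x : Pt (k + 2)) :
    inner ℝ (intPt (truncNormal k J (Sum.inl j))) x = -x j := by
  rw [inner_intPt]
  simp [truncNormal, Pi.single_apply]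

theorem inner_truncNormal_inr (i : Fin (J + 1)) (x : Pt (k + 2)) :
    inner ℝ (intPt (truncNormal k J (Sum.inr i))) x =
      x 0 + (1 - (i : ℝ)) * ∑ j : Fin (k + 1), x j.succ := by
  rw [inner_intPt, Fin.sum_univ_succ]
  simp [truncNormal, Fin.succ_ne_zero, Finset.mul_sum]

theorem one_le_truncBound {i : ℕ} (hi : i ≤ J) : 1 ≤ truncBound J i := by
  have h1 : (0 : ℝ) ≤ (J : ℝ) - i := sub_nonneg.2 (by exact_mod_cast hi)
  have : 0 ≤ ((J : ℝ) - i) * ((J : ℝ) - i + 1) / 2 := by positivity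
  rw [truncBound]
  linarith

theorem truncNormal_ne_zero (i : Fin (k + 2) ⊕ Fin (J + 1)) : truncNormal k J i ≠ 0 := by
  rcases i with j | i <;> intro h
  · have := congrFun h j
    simp [truncNormal] at this
  · have := congrFun h 0
    simp [truncNormal] at this

/-- The lower bounds on the coordinates and the upper constraint i = 0, which bounds their sum,
already confine the polyhedron to a simplex. -/
theorem isBounded_truncPoly (h : Fin (k + 2) ⊕ Fin (J + 1) → ℝ) :
    Bornology.IsBounded (poly (fun i => intPt (truncNormal k J i)) h) := by
  set B := ∑ j, |h (Sum.inl j)| with hB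
  refine ((PiLp.antilipschitzWith_ofLp 2 (fun _ : Fin (k + 2) => ℝ)).isBounded_preimage
    (isBounded_Icc (fun _ => -B) (fun _ => h (Sum.inr 0) + B))).subset fun x hx => ?_
  have hlow : ∀ j, -|h (Sum.inl j)| ≤ x j := by
    intro j
    have h1 := hx (Sum.inl j)
    rw [inner_truncNormal_inl] at h1
    linarith [le_abs_self (h (Sum.inl j))]
  have hup : ∑ j, x j ≤ h (Sum.inr 0) := by
    have h1 := hx (Sum.inr 0)
    rw [inner_truncNormal_inr] at h1
    rw [Fin.sum_univ_succ]
    simpa using h1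
  have hle : ∀ j, |h (Sum.inl j)| ≤ B := fun j =>
    Finset.single_le_sum (f := fun j => |h (Sum.inl j)|) (fun _ _ => abs_nonneg _)
      (Finset.mem_univ j)
  refine ⟨fun j => (neg_le_neg (hle j)).trans (hlow j), fun j => ?_⟩
  have h2 : x j + |h (Sum.inl j)| ≤ ∑ l, (x l + |h (Sum.inl l)|) :=
    Finset.single_le_sum (f := fun l => x l + |h (Sum.inl l)|)
      (fun l _ => by linarith [hlow l]) (Finset.mem_univ j)
  rw [Finset.sum_add_distrib] at h2
  change x j ≤ _
  linarith [abs_nonneg (h (Sum.inl j))]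

/-- The vector -e_j is dual to itself among the lower normals. Adding t, which vanishes on the
active lower coordinates, cancels its pairing with the active upper normals. -/
theorem isDualOn_truncNormal {I : Set (Fin (k + 2) ⊕ Fin (J + 1))} (t : Fin (k + 2) → ℤ)
    (q : Fin (J + 1) → Fin (k + 2) → ℤ) (ht : ∀ j, Sum.inl j ∈ I → t j = 0)
    (htv : ∀ j i, Sum.inl j ∈ I → Sum.inr i ∈ I →
      t ⬝ᵥ truncNormal k J (Sum.inr i) = truncNormal k J (Sum.inr i) j)
    (hq : ∀ j i, Sum.inl j ∈ I → Sum.inr i ∈ I → q i j = 0)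
    (hqq : ∀ i, Sum.inr i ∈ I → q i ⬝ᵥ truncNormal k J (Sum.inr i) = 1)
    (hqn : ∀ i l, Sum.inr i ∈ I → Sum.inr l ∈ I → i ≠ l →
      q i ⬝ᵥ truncNormal k J (Sum.inr l) = 0) :
    IsDualOn (truncNormal k J) (Sum.elim (fun j => t - Pi.single j 1) q) I := by
  have hinl : ∀ (a : Fin (k + 2) → ℤ) j, a ⬝ᵥ truncNormal k J (Sum.inl j) = -a j := by
    intro a j
    simp [truncNormal]
  constructor
  · rintro (j | i) hi
    · simp [hinl, ht j hi]
    · exact hqq i hi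
  · rintro (j | i) hi (j' | i') hi' hne
    · have : j' ≠ j := fun h => hne (by rw [h])
      simp [hinl, ht j' hi', this]
    · simp only [Sum.elim_inl, sub_dotProduct, htv j i' hi hi', single_one_dotProduct, sub_self]
    · simp [hinl, hq j' i hi' hi]
    · exact hqn i i' hi hi' fun h => hne (by rw [h])

/-- At most two upper constraints are tight at a point, and two tight ones are neighbours. In each
case x₀ or some other nonzero coordinate j₀ provides the free directions for the dual vectors. -/
theorem isSmooth_trunc (k J : ℕ) : IsSmooth (truncNormal k J) (truncHeight k J) := by
  intro x hx
  set I := active (fun i => intPt (truncNormal k J i)) (truncHeight k J) x with hI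
  set s := ∑ j : Fin (k + 1), x j.succ with hs
  have hxj : ∀ j, 0 ≤ x j := by
    intro j
    have h1 := hx (Sum.inl j)
    rw [inner_truncNormal_inl] at h1
    simpa [truncHeight] using h1
  have hs0 : 0 ≤ s := Finset.sum_nonneg fun j _ => hxj _
  have hup : ∀ i : Fin (J + 1), x 0 + (1 - (i : ℝ)) * s ≤ truncBound J i := by
    intro i
    have h1 := hx (Sum.inr i)
    rwa [inner_truncNormal_inr] at h1
  have hinl : ∀ j, Sum.inl j ∈ I → x j = 0 := by
    intro j hj
    have h1 := mem_active.1 hj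
    rw [inner_truncNormal_inl] at h1
    simpa [truncHeight] using h1
  have hinr : ∀ i, Sum.inr i ∈ I → x 0 + (1 - (i : ℝ)) * s = truncBound J i := by
    intro i hi
    have h1 := mem_active.1 hi
    rwa [inner_truncNormal_inr] at h1
  have hpos : 0 < s → ∃ j : Fin (k + 2), j ≠ 0 ∧ x j ≠ 0 := by
    intro h
    obtain ⟨j, -, hj⟩ := Finset.exists_ne_zero_of_sum_ne_zero h.ne'
    exact ⟨j.succ, Fin.succ_ne_zero j, hj⟩
  -- The heights satisfy c i - c (i + 1) = J - i. If i is tight, constraint i + 1 gives s ≥ J - i.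
  -- If i < l are both tight, s is the mean of J - i and J - l + 1, which forces l = i + 1.
  have hcons : ∀ i l, Sum.inr i ∈ I → Sum.inr l ∈ I → i < l →
      (l : ℕ) = i + 1 ∧ s = (J : ℝ) - i := by
    intro i l hi hl hil
    have h1 := hinr i hi
    have h2 := hinr l hl
    have hl' := l.2
    have hil' : (i : ℕ) < l := hil
    have h3 := hup ⟨i + 1, by omega⟩
    simp only [truncBound] at h1 h2 h3
    push_cast at h3
    have h4 : (i : ℝ) + 1 ≤ l := by exact_mod_cast hil'
    have h5 : (J : ℝ) - i ≤ s := by nlinarith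
    have h6 : s = ((J : ℝ) - i + (J - l) + 1) / 2 := by
      have h7 : ((l : ℝ) - i) * (s - ((J : ℝ) - i + (J - l) + 1) / 2) = 0 := by nlinarith
      have h8 : (l : ℝ) - i ≠ 0 := by linarith
      have := (mul_eq_zero.1 h7).resolve_left h8
      linarith
    have h9 : (l : ℝ) = i + 1 := by linarith
    exact ⟨by exact_mod_cast h9, by rw [h6, h9]; ring⟩
  have hval0 : ∀ i, truncNormal k J (Sum.inr i) 0 = 1 := fun i => by simp [truncNormal]
  have hval : ∀ i j, j ≠ 0 → truncNormal k J (Sum.inr i) j = 1 - (i : ℤ) := fun i j hj => by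
    simp [truncNormal, hj]
  by_cases hex : ∃ i, Sum.inr i ∈ I
  · by_cases htwo : ∃ i l, Sum.inr i ∈ I ∧ Sum.inr l ∈ I ∧ i < l
    · obtain ⟨i, l, hi, hl, hil⟩ := htwo
      obtain ⟨hli, hsi⟩ := hcons i l hi hl hil
      have hJ : (i : ℝ) + 1 ≤ J := by
        have := l.2
        exact_mod_cast (by omega : (i : ℕ) + 1 ≤ J)
      obtain ⟨j₀, hj₀, hxj₀⟩ := hpos (by rw [hsi]; linarith)
      -- With a = J - i ≥ 1, x₀ = 0 would give (1 - i) a = 1 + a (a + 1) / 2, whose left side is at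
      -- most a and whose right side exceeds a.
      have hx0 : x 0 ≠ 0 := by
        intro h0
        have h1 := hinr i hi
        rw [h0, hsi, truncBound] at h1
        nlinarith [mul_nonneg (Nat.cast_nonneg (α := ℝ) (i : ℕ)) (by linarith : (0 : ℝ) ≤ J - i)]
      have hor : ∀ m, Sum.inr m ∈ I → m = i ∨ m = l := by
        intro m hm
        rcases lt_trichotomy m i with h | h | h
        · have h1 := (hcons m i hm hi h).1
          have h2 := (hcons m l hm hl (h.trans hil)).1
          omega
        · exact Or.inl h
        · have h1 := (hcons i m hi hm h).1
          exact Or.inr (Fin.ext (by omega))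
      have hne : l ≠ i := hil.ne'
      have hli' : (l : ℤ) = i + 1 := by exact_mod_cast hli
      -- On the coordinates 0 and j₀ the two tight normals are (1, 1 - i) and (1, -i), of
      -- determinant -1; the vectors (i, 1) and (1 - i, -1) are dual to them.
      refine ⟨_, isDualOn_truncNormal (Pi.single j₀ 1)
        (fun m => if m = i then (i : ℤ) • Pi.single 0 1 + Pi.single j₀ 1
          else (1 - (i : ℤ)) • Pi.single 0 1 - Pi.single j₀ 1) ?_ ?_ ?_ ?_ ?_⟩
      · intro j hj
        have : j ≠ j₀ := fun h => hxj₀ (h ▸ hinl j hj)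
        simp [this]
      · intro j m hj hm
        have : j ≠ 0 := fun h => hx0 (h ▸ hinl j hj)
        rw [single_one_dotProduct, hval m j₀ hj₀, hval m j this]
      · intro j m hj hm
        have h1 : j ≠ 0 := fun h => hx0 (h ▸ hinl j hj)
        have h2 : j ≠ j₀ := fun h => hxj₀ (h ▸ hinl j hj)
        split_ifs <;> simp [h1, h2]
      · intro m hm
        rcases hor m hm with rfl | rfl
        · simp only [if_true, add_dotProduct, smul_dotProduct, single_one_dotProduct, hval0,
            hval _ _ hj₀, smul_eq_mul]
          ring
        · simp only [hne, if_false, sub_dotProduct, smul_dotProduct, single_one_dotProduct, hval0,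
            hval _ _ hj₀, smul_eq_mul, hli']
          ring
      · intro m m' hm hm' hmm
        rcases hor m hm with rfl | rfl <;> rcases hor m' hm' with rfl | rfl
        · exact absurd rfl hmm
        · simp only [if_true, add_dotProduct, smul_dotProduct, single_one_dotProduct, hval0,
            hval _ _ hj₀, smul_eq_mul, hli']
          ring
        · simp only [hne, if_false, sub_dotProduct, smul_dotProduct, single_one_dotProduct, hval0,
            hval _ _ hj₀, smul_eq_mul]
          ring
        · exact absurd rfl hmm
    · obtain ⟨i, hi⟩ := hex
      have honly : ∀ m, Sum.inr m ∈ I → m = i := by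
        intro m hm
        rcases lt_trichotomy m i with h | h | h
        · exact absurd ⟨m, i, hm, hi, h⟩ htwo
        · exact h
        · exact absurd ⟨i, m, hi, hm, h⟩ htwo
      by_cases hx0 : x 0 = 0
      · have h1 := hinr i hi
        have h2 := one_le_truncBound (J := J) (Nat.lt_succ_iff.1 i.2)
        rw [← h1, hx0, zero_add] at h2
        -- When x₀ = 0, tightness reads (1 - i) s = c i ≥ 1 with s ≥ 0, so only i = 0 is possible;
        -- its normal has all entries 1.
        have hi0 : (i : ℕ) = 0 := by
          by_contra hne
          have h3 : (1 : ℝ) ≤ i := by exact_mod_cast Nat.one_le_iff_ne_zero.2 hne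
          nlinarith
        rw [hi0] at h2
        obtain ⟨j₀, hj₀, hxj₀⟩ := hpos (by push_cast at h2; linarith)
        have hone : ∀ j, truncNormal k J (Sum.inr i) j = 1 := fun j => by
          by_cases hj : j = 0
          · rw [hj, hval0]
          · rw [hval i j hj, hi0]; rfl
        refine ⟨_, isDualOn_truncNormal (Pi.single j₀ 1) (fun _ => Pi.single j₀ 1)
          ?_ ?_ ?_ ?_ ?_⟩
        · intro j hj
          have : j ≠ j₀ := fun h => hxj₀ (h ▸ hinl j hj)
          simp [this]
        · intro j m hj hm
          rw [honly m hm, single_one_dotProduct, hone, hone]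
        · intro j m hj hm
          have : j ≠ j₀ := fun h => hxj₀ (h ▸ hinl j hj)
          simp [this]
        · intro m hm
          rw [honly m hm, single_one_dotProduct, hone]
        · intro m m' hm hm' hmm
          exact absurd ((honly m hm).trans (honly m' hm').symm) hmm
      · refine ⟨_, isDualOn_truncNormal ((1 - (i : ℤ)) • Pi.single 0 1) (fun _ => Pi.single 0 1)
          ?_ ?_ ?_ ?_ ?_⟩
        · intro j hj
          have : j ≠ 0 := fun h => hx0 (h ▸ hinl j hj)
          simp [this]
        · intro j m hj hm
          have : j ≠ 0 := fun h => hx0 (h ▸ hinl j hj)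
          rw [honly m hm, smul_dotProduct, single_one_dotProduct, hval0, hval i j this,
            smul_eq_mul, mul_one]
        · intro j m hj hm
          have : j ≠ 0 := fun h => hx0 (h ▸ hinl j hj)
          simp [this]
        · intro m hm
          rw [single_one_dotProduct, hval0]
        · intro m m' hm hm' hmm
          exact absurd ((honly m hm).trans (honly m' hm').symm) hmm
  · have hno : ∀ i, Sum.inr i ∉ I := fun i hi => hex ⟨i, hi⟩
    exact ⟨_, isDualOn_truncNormal 0 0 (fun _ _ => rfl) (fun _ i _ hi => absurd hi (hno i))
      (fun _ i _ hi => absurd hi (hno i)) (fun i hi => absurd hi (hno i))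
      (fun i _ hi => absurd hi (hno i))⟩

/-- Upper constraint i is the only tight upper one for s strictly between the breaks J - i and J - i
+ 1 (for i = 0, just above J), with x₀ > 0 chosen to make it tight. -/
theorem isIrredundant_trunc (k J : ℕ) : IsIrredundant (truncNormal k J) (truncHeight k J) := by
  rintro (j | i)
  -- The k + 2 coordinates are at most δ each, so their sum stays below 1, a lower bound for every c
  -- i.
  · set δ : ℝ := 1 / ((k : ℝ) + 3) with hδ
    have hδ0 : 0 < δ := by positivity
    set p : Pt (k + 2) := WithLp.toLp 2 fun l => if l = j then 0 else δ with hp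
    have hpl : ∀ l, p l = if l = j then 0 else δ := fun l => rfl
    have hp0 : ∀ l, 0 ≤ p l := fun l => by rw [hpl]; split_ifs <;> linarith
    have hpδ : ∀ l, p l ≤ δ := fun l => by rw [hpl]; split_ifs <;> linarith
    refine ⟨p, ?_, ?_⟩
    · rw [inner_truncNormal_inl]
      simp [hpl, truncHeight]
    · rintro (l | i) hl
      · have : l ≠ j := fun h => hl (by rw [h])
        rw [inner_truncNormal_inl]
        simpa [hpl, this, truncHeight] using hδ0
      · rw [inner_truncNormal_inr]
        refine lt_of_lt_of_le ?_ (one_le_truncBound (J := J) (Nat.lt_succ_iff.1 i.2))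
        have h1 : ∑ l : Fin (k + 1), p l.succ ≤ ((k : ℝ) + 1) * δ := by
          refine (Finset.sum_le_card_nsmul _ _ δ fun l _ => hpδ _).trans_eq ?_
          simp
        have h2 : 0 ≤ ∑ l : Fin (k + 1), p l.succ := Finset.sum_nonneg fun l _ => hp0 _
        have h3 : 0 ≤ (i : ℝ) * ∑ l : Fin (k + 1), p l.succ := by positivity
        have h4 : ((k : ℝ) + 3) * δ = 1 := by rw [hδ]; field_simp
        nlinarith [hpδ 0]
  · have hiJ : (i : ℝ) ≤ J := by exact_mod_cast Nat.lt_succ_iff.1 i.2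
    have hi0 : (0 : ℝ) ≤ i := Nat.cast_nonneg _
    -- Halfway past the break J - i, the slack of constraint l is exactly (l - i)² / 2.
    set σ : ℝ := (J : ℝ) - i + 1 / 2 with hσ
    have hσ0 : 0 < σ := by linarith
    set x₀ : ℝ := truncBound J i + ((i : ℝ) - 1) * σ with hx₀
    have hx₀0 : 0 < x₀ := by
      rw [hx₀, truncBound, hσ]
      nlinarith [mul_nonneg hi0 (sub_nonneg.2 hiJ), sq_nonneg ((J : ℝ) - i - 1 / 2)]
    set p : Pt (k + 2) := WithLp.toLp 2 (Fin.cons x₀ fun _ => σ / ((k : ℝ) + 1)) with hp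
    have hp0 : p 0 = x₀ := rfl
    have hps : ∀ l : Fin (k + 1), p l.succ = σ / ((k : ℝ) + 1) := fun l => rfl
    have hsum : ∑ l : Fin (k + 1), p l.succ = σ := by
      simp only [hps, Finset.sum_const, Finset.card_univ, Fintype.card_fin, nsmul_eq_mul]
      push_cast
      field_simp
    refine ⟨p, ?_, ?_⟩
    · rw [inner_truncNormal_inr, hsum, hp0, hx₀]
      simp only [truncHeight]
      ring
    · rintro (l | l) hl
      · rw [inner_truncNormal_inl]
        simp only [truncHeight, neg_lt_zero]
        refine Fin.cases ?_ (fun l => ?_) l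
        · exact hx₀0
        · rw [hps]; positivity
      · have hne : (l : ℝ) ≠ i := fun h => hl (by
          rw [Fin.ext (by exact_mod_cast h : (l : ℕ) = i)])
        rw [inner_truncNormal_inr, hsum, hp0]
        simp only [truncHeight]
        have h1 : truncBound J l - (x₀ + (1 - (l : ℝ)) * σ) = ((l : ℝ) - i) ^ 2 / 2 := by
          rw [hx₀, truncBound, truncBound, hσ]
          ring
        have h2 : 0 < ((l : ℝ) - i) ^ 2 := by
          have := sub_ne_zero.2 hne
          positivity
        linarith

end Family

/-! ### Lower bounds for every number of facets, and the conclusion -/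

theorem le_dimH_of_two_le {n m : ℕ} (hn : 2 ≤ n) (hm : n + 1 ≤ m) :
    (m : ℝ≥0∞) ≤ dimH (delzantFacetsH n m) ∧ (m : ℝ≥0∞) ≤ dimH (delzantFacetsQuot n m) := by
  obtain ⟨k, rfl⟩ := Nat.exists_eq_add_of_le' hn
  obtain ⟨J, rfl⟩ := Nat.exists_eq_add_of_le hm
  have hcard : Fintype.card (Fin (k + 2) ⊕ Fin (J + 1)) = k + 2 + 1 + J := by
    simp only [Fintype.card_sum, Fintype.card_fin]
    ring
  rw [← hcard]
  exact ⟨le_dimH_delzantFacetsH truncNormal_ne_zero isBounded_truncPoly (isSmooth_trunc k J)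
    (isIrredundant_trunc k J), le_dimH_delzantFacetsQuot truncNormal_ne_zero isBounded_truncPoly
    (isSmooth_trunc k J) (isIrredundant_trunc k J)⟩

theorem eq_top_of_forall_natCast_le {a : ℝ≥0∞} (N : ℕ) (h : ∀ m : ℕ, N ≤ m → (m : ℝ≥0∞) ≤ a) :
    a = ⊤ := by
  by_contra hne
  obtain ⟨m, hm⟩ := ENNReal.exists_nat_gt hne
  exact absurd (h (max N m) (le_max_left _ _)) (not_le.2 (hm.trans_le (by
    exact_mod_cast le_max_right N m)))

end Delzant

theorem mainTheorem7 (n : ℕ) (hn : 2 ≤ n) :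
    (∀ m : ℕ, n + 1 ≤ m →
      dimH (Delzant.delzantFacetsH n m) = m ∧
      dimH (Delzant.delzantFacetsV n m) = m ∧
      dimH (Delzant.delzantFacetsQuot n m) = m) ∧
    dimH (Delzant.delzantH n) = ⊤ ∧
    dimH (Delzant.delzantV n) = ⊤ ∧
    dimH (Delzant.delzantQuot n) = ⊤ := by
  have hn0 : 0 < n := by omega
  have key : ∀ m : ℕ, n + 1 ≤ m → dimH (Delzant.delzantFacetsH n m) = m ∧
      dimH (Delzant.delzantFacetsV n m) = m ∧ dimH (Delzant.delzantFacetsQuot n m) = m := by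
    intro m hm
    obtain ⟨h1, h2⟩ := Delzant.le_dimH_of_two_le hn hm
    have h3 := Delzant.dimH_delzantFacetsV_le (m := m) hn0
    have h4 := Delzant.dimH_delzantFacetsQuot_le (n := n) (m := m)
    -- The chain m ≤ dim of the quotient ≤ dim for δ^V ≤ m settles the last two equalities together.
    exact ⟨(Delzant.dimH_delzantFacetsH_le hn0).antisymm h1, h3.antisymm (h2.trans h4),
      (h4.trans h3).antisymm h2⟩
  refine ⟨key, ?_, ?_, ?_⟩ <;> refine Delzant.eq_top_of_forall_natCast_le (n + 1) fun m hm => ?_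
  · exact (key m hm).1.ge.trans (dimH_mono fun _ h => h.1)
  · exact (key m hm).2.1.ge.trans (dimH_mono fun _ h => h.1)
  · exact (key m hm).2.2.ge.trans (dimH_mono (Set.image_mono fun _ h => h.1))
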